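/- Let $G=(V,E)$ be a finite connected simple graph with a vertex measure $m_1:V\to(0,\infty)$ and a symmetric edge measure $m_2:E\to[0,\infty)$. For a connected graph $K=(V,E_K)$ with $E_K\subseteq E$ and a weight $\omega:E_K\to(0,\infty)$, let $d_\omega(u,v)$ be the infimum of the $\omega$-lengths of the walks in $K$ from $u$ to $v$. Put $\mathrm{Deg}(x)=\frac1{m_1(x)}\sum_{y\sim x}m_2(x,y)$ (neighbours in $K$), and for small $\epsilon>0$ let $m_x^\epsilon(x)=1-\epsilon\,\mathrm{Deg}(x)$, $m_x^\epsilon(y)=\epsilon\, m_2(x,y)/m_1(x)$ for $y\sim x$, and $m_x^\epsilon(y)=0$ otherwise. Let $W$ be the Wasserstein distance for the cost $d_\omega$ (the infimum of $\sum_{u,v} d_\omega(u,v)A(u,v)$ over transport plans $A$). The weighted Lin-Lu-Yau curvature of $K$ is $$\kappa_\omega(x,y)=\lim_{\epsilon\to0^+}\frac1\epsilon\left(1-\frac{W(m_x^\epsilon,m_y^\epsilon)}{d_\omega(x,y)}\right)\qquad(x\ne y).$$ An edge is called degenerate for $\omega$ if it is not the unique shortest path between its endpoints, i.e. if some other walk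 between them has $\omega$-length at most $\omega(e)$; $\omega$ is non-degenerate if no edge is degenerate. Surgery deletes all degenerate edges simultaneously. **Theorem.** The limit defining $\kappa_\omega(x,y)$ on $G$ exists for every positive weight $\omega$ on $E$ and all $x\neq y$. For every initial weight $\omega_0:E\to(0,\infty)$: 1. The weighted Lin-Lu-Yau flow on $G$, $$\frac{d}{dt}\omega(t,e)=-\kappa_{\omega(t)}(e)\,\omega(t,e)\quad (t>0,\ e\in E),\qquad \omega(0,e)=\omega_0(e),$$ with $\omega$ continuous at $t=0$, has a positive solution for all $t\ge 0$. It is unique: every positive solution on some $[0,T)$, $T\le\infty$, agrees with it on $[0,T)$. 2. The flow with edge surgery has a positive solution for all $t\ge0$, unique in the same sense. This is a family of graphs $H_t\subseteq G$ and positive weights $\omega(t,\cdot)$ on the edges of $H_t$, non-degenerate for $H_t$ at every $t\ge 0$, such that: $\omega(0,\cdot)=\omega_0$ on $E$, and $H_0$ is obtained from $(G,\omega_0)$ by surgery; $t\mapsto H_t$ is constant on a right neighbourhood of each $t\ge0$, and on a left neighbourhood of each $t>0$ it equals some constant graph $K$; the weights of the edges of $H_t$ are continuous from the right at $t$; the weights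 of the edges of $K$ are continuous from the left at $t$ with positive values there, and $H_t$ is obtained from $K$ with these values by surgery; and at every $t>0$ near which $H$ is constant, $\frac{d}{dt}\omega(t,e)=-\kappa_{\omega(t)}(e)\,\omega(t,e)$ for each edge $e$ of $H_t$, with $\kappa$ computed in $H_t$. Uniqueness means that any such solution on $[0,T)$, $T\le\infty$, has the same graphs $H_t$ and the same weights on the edges of $H_t$ for all $0\le t<T$. -/

import Mathlib

open Set Filter Topology

namespace WeightedLLY

variable {V : Type*}

/-- The total weight `∑ ω(v_k, v_{k-1})` of a walk. -/
def walkWeight {G : SimpleGraph V} (w : Sym2 V → ℝ) {u v : V} (p : G.Walk u v) : ℝ :=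
  (p.edges.map w).sum

/-- The path distance `d_ω(u,v)`: the infimum of the weights of all walks from `u` to `v`.
(It is only used for connected graphs and positive weights.) -/
noncomputable def pathDist (G : SimpleGraph V) (w : Sym2 V → ℝ) (u v : V) : ℝ :=
  ⨅ p : G.Walk u v, walkWeight w p

open Classical in
/-- `Deg(x) = (∑_{y ∼ x} m₂(x,y)) / m₁(x)`. -/
noncomputable def wDeg [Fintype V] (G : SimpleGraph V) (m₁ : V → ℝ) (m₂ : Sym2 V → ℝ)
    (x : V) : ℝ :=
  (∑ y : V, if G.Adj x y then m₂ s(x, y) else 0) / m₁ x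

open Classical in
/-- The transition kernel `m_x^ε(y)`. -/
noncomputable def transKernel [Fintype V] (G : SimpleGraph V) (m₁ : V → ℝ) (m₂ : Sym2 V → ℝ)
    (ε : ℝ) (x y : V) : ℝ :=
  if y = x then 1 - ε * wDeg G m₁ m₂ x
  else if G.Adj x y then ε * m₂ s(x, y) / m₁ x
  else 0

/-- `A` is a transport plan from `μ` to `ν`. -/
structure IsTransportPlan [Fintype V] (μ ν : V → ℝ) (A : V → V → ℝ) : Prop where
  nonneg : ∀ u v, 0 ≤ A u v
  le_one : ∀ u v, A u v ≤ 1
  source : ∀ u, ∑ v, A u v = μ u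
  target : ∀ v, ∑ u, A u v = ν v

/-- The Wasserstein distance of `μ` and `ν` for the cost `d`. -/
noncomputable def wasserstein [Fintype V] (d : V → V → ℝ) (μ ν : V → ℝ) : ℝ :=
  sInf {c : ℝ | ∃ A : V → V → ℝ, IsTransportPlan μ ν A ∧ c = ∑ u, ∑ v, d u v * A u v}

/-- The quotient `(1/ε) (1 - W(m_x^ε, m_y^ε) / d_ω(x,y))`. -/
noncomputable def llyQuotient [Fintype V] (G : SimpleGraph V) (m₁ : V → ℝ) (m₂ : Sym2 V → ℝ)
    (w : Sym2 V → ℝ) (x y : V) (ε : ℝ) : ℝ :=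
  1 / ε * (1 - wasserstein (pathDist G w) (transKernel G m₁ m₂ ε x) (transKernel G m₁ m₂ ε y)
    / pathDist G w x y)

/-- The weighted Lin-Lu-Yau curvature `κ_ω(x,y)`: the limit of the quotient as `ε → 0⁺`. -/
noncomputable def llyCurvature [Fintype V] (G : SimpleGraph V) (m₁ : V → ℝ) (m₂ : Sym2 V → ℝ)
    (w : Sym2 V → ℝ) (x y : V) : ℝ :=
  limUnder (𝓝[>] (0 : ℝ)) (llyQuotient G m₁ m₂ w x y)

/-- `ω` is a positive solution on `[0,T)` (where `T = ⊤` is allowed) of the flow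
`dω/dt = -κ_ω ω` on the fixed graph `G` with initial weight `w₀`.
Only the values of `ω` on the edges of `G` matter. -/
structure IsFlow [Fintype V] (G : SimpleGraph V) (m₁ : V → ℝ) (m₂ : Sym2 V → ℝ)
    (w₀ : Sym2 V → ℝ) (T : EReal) (ω : ℝ → Sym2 V → ℝ) : Prop where
  init : ∀ e ∈ G.edgeSet, ω 0 e = w₀ e
  pos : ∀ t : ℝ, 0 ≤ t → (t : EReal) < T → ∀ e ∈ G.edgeSet, 0 < ω t e
  /-- The initial value is attained continuously. -/
  cont_zero : ∀ e ∈ G.edgeSet, ContinuousWithinAt (fun s => ω s e) (Ici 0) 0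
  deriv : ∀ t : ℝ, 0 < t → (t : EReal) < T → ∀ x y : V, G.Adj x y →
    HasDerivAt (fun s => ω s s(x, y))
      (-(llyCurvature G m₁ m₂ (ω t) x y) * ω t s(x, y)) t

/-- An edge `e` of `G` is degenerate for the weight `w` if it is not the unique shortest path
between its endpoints: some other walk between them is at most as long as `e`. -/
def IsDegenerateEdge (G : SimpleGraph V) (w : Sym2 V → ℝ) (e : Sym2 V) : Prop :=
  ∃ (x y : V) (h : G.Adj x y) (p : G.Walk x y),
    e = s(x, y) ∧ p ≠ h.toWalk ∧ walkWeight w p ≤ w e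

/-- Every edge is the unique shortest path between its endpoints. -/
def NonDegenerate (G : SimpleGraph V) (w : Sym2 V → ℝ) : Prop :=
  ∀ e ∈ G.edgeSet, ¬ IsDegenerateEdge G w e

/-- Edge surgery: all degenerate edges are deleted. -/
def surgery (G : SimpleGraph V) (w : Sym2 V → ℝ) : SimpleGraph V :=
  G.deleteEdges {e | IsDegenerateEdge G w e}

/-- `(H, ω)` is a positive solution on `[0,T)` (where `T = ⊤` is allowed) of the Lin-Lu-Yau flow
with edge surgery, started from the graph `G` with the weight `w₀`. Here `H t` is the graph at
time `t`, after a possible surgery at that time, and only the values `ω t e` for edges `e` that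
are present at time `t` or immediately before time `t` matter. -/
structure IsSurgeryFlow [Fintype V] (G : SimpleGraph V) (m₁ : V → ℝ) (m₂ : Sym2 V → ℝ)
    (w₀ : Sym2 V → ℝ) (T : EReal) (H : ℝ → SimpleGraph V) (ω : ℝ → Sym2 V → ℝ) : Prop where
  init : ∀ e ∈ G.edgeSet, ω 0 e = w₀ e
  init_graph : H 0 = surgery G w₀
  pos : ∀ t : ℝ, 0 ≤ t → (t : EReal) < T → ∀ e ∈ (H t).edgeSet, 0 < ω t e
  nonDegenerate : ∀ t : ℝ, 0 ≤ t → (t : EReal) < T → NonDegenerate (H t) (ω t)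
  /-- After each time `t` the graph stays the same for a while, and the weights of its edges are
  continuous from the right at `t`. -/
  right : ∀ t : ℝ, 0 ≤ t → (t : EReal) < T →
    (∀ᶠ s in 𝓝[≥] t, H s = H t) ∧
      ∀ e ∈ (H t).edgeSet, ContinuousWithinAt (fun s => ω s e) (Ici t) t
  /-- Just before each time `t > 0` the graph is some constant graph `K`; the weights of the edges
  of `K` have positive limits at `t`, and `H t` is obtained from `K` by surgery. So `H t = K`
  unless some edge of `K` becomes degenerate at time `t`. -/
  left : ∀ t : ℝ, 0 < t → (t : EReal) < T → ∃ K : SimpleGraph V,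
    (∀ᶠ s in 𝓝[<] t, H s = K) ∧
      (∀ e ∈ K.edgeSet, 0 < ω t e ∧ ContinuousWithinAt (fun s => ω s e) (Iic t) t) ∧
      H t = surgery K (ω t)
  /-- The flow equation for the current graph, at all times without surgery. -/
  deriv : ∀ t : ℝ, 0 < t → (t : EReal) < T → (∀ᶠ s in 𝓝 t, H s = H t) →
    ∀ x y : V, (H t).Adj x y →
      HasDerivAt (fun s => ω s s(x, y))
        (-(llyCurvature (H t) m₁ m₂ (ω t) x y) * ω t s(x, y)) t

end WeightedLLY

/-!
The curvature is the value of a linear program. The kernels are `m_x^ε = δ_x + ε p_x` with a fixed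
`p_x` (`kernelRate`), so a transport plan from `m_x^ε` to `m_y^ε` is a matrix `E_{xy} + ε B`, where
`B` has the marginals `p_x` and `p_y` and nonnegative entries except perhaps at `(x, y)`
(`IsRatePlan`). The marginals force `B x y ≥ -(Deg x + Deg y)`, so the positivity of the plan at
`(x, y)` is automatic once `ε (Deg x + Deg y) ≤ 1`. Therefore the Wasserstein distance is exactly
`d x y + ε c` for small `ε`, with `c = transportRate d x y` the least value of `∑ d B`
(`wasserstein_transKernel`), the quotient defining the curvature is eventually constant, and
`κ = -c / d`. No duality is needed. The set of all `B` is bounded and does not depend on `d`, and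
so `c` is Lipschitz in `d`; moreover `-(Deg x + Deg y) d x y ≤ c ≤ C max d`.

For the logarithms `u = log ω` the flow is the equation `u_e' = c_e / d_e`, whose right side is
locally Lipschitz because path distances are Lipschitz in the weight. This gives uniqueness by
Gronwall's inequality (`IsFlowOn.eq_right`). For existence on `[0, T]` the field is cut off so that
it becomes bounded, and the Picard–Lindelöf theorem yields a solution on all of `[0, T]`. The
cut-offs turn out to be inactive: the lower bound on `c` keeps `u_e` from decreasing more than
linearly, and all distances grow at most exponentially, because an edge on a shortest path has
`ω_e = d_e`, so that `ω_e' = c_e ≤ C max d` there (`pathDist_le_of_hasDerivAt_logField`).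

The flow with surgery is the flow on `surgery G ω₀`, run until some edge becomes degenerate.
Degeneracy is a closed condition by `nonDegenerate_iff`, so a first such time exists; the surgery at
that time keeps the graph connected (`connected_surgery`) and removes an edge, so the construction
ends after finitely many surgeries. Uniqueness follows by real induction: between surgeries from
uniqueness on a fixed graph, and at a surgery because the new graph is determined by the limiting
weights.
-/

namespace WeightedLLY

/-! ### The curvature as a linear optimization problem -/

section TransportRate

variable {V : Type*} [Fintype V] {G : SimpleGraph V} {m₁ : V → ℝ} {m₂ : Sym2 V → ℝ}

open Classical in
/-- The derivative in `ε` of the transition kernel: `m_x^ε = δ_x + ε • kernelRate x`. -/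
noncomputable def kernelRate (G : SimpleGraph V) (m₁ : V → ℝ) (m₂ : Sym2 V → ℝ) (x u : V) : ℝ :=
  if u = x then -wDeg G m₁ m₂ x else if G.Adj x u then m₂ s(x, u) / m₁ x else 0

open Classical in
theorem transKernel_eq (ε : ℝ) (x u : V) :
    transKernel G m₁ m₂ ε x u = (if u = x then 1 else 0) + ε * kernelRate G m₁ m₂ x u := by
  unfold transKernel kernelRate
  split_ifs <;> ring

theorem kernelRate_self (x : V) : kernelRate G m₁ m₂ x x = -wDeg G m₁ m₂ x := by
  simp [kernelRate]

theorem kernelRate_nonneg (hm₁ : ∀ x, 0 < m₁ x) (hm₂ : ∀ e ∈ G.edgeSet, 0 ≤ m₂ e) {x u : V}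
    (h : u ≠ x) : 0 ≤ kernelRate G m₁ m₂ x u := by
  unfold kernelRate
  rw [if_neg h]
  split_ifs with hA
  · exact div_nonneg (hm₂ _ hA) (hm₁ x).le
  · exact le_rfl

theorem wDeg_nonneg (hm₁ : ∀ x, 0 < m₁ x) (hm₂ : ∀ e ∈ G.edgeSet, 0 ≤ m₂ e) (x : V) :
    0 ≤ wDeg G m₁ m₂ x := by
  unfold wDeg
  refine div_nonneg (Finset.sum_nonneg fun y _ => ?_) (hm₁ x).le
  split_ifs with hA
  · exact hm₂ _ hA
  · exact le_rfl

theorem sum_kernelRate (x : V) : ∑ u, kernelRate G m₁ m₂ x u = 0 := by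
  classical
  have h : ∀ u, kernelRate G m₁ m₂ x u =
      (if u = x then -wDeg G m₁ m₂ x else 0) + (if G.Adj x u then m₂ s(x, u) else 0) / m₁ x := by
    intro u
    unfold kernelRate
    by_cases hu : u = x
    · subst hu; simp
    · simp only [hu, if_false]; split_ifs <;> simp
  simp only [h, Finset.sum_add_distrib, ← Finset.sum_div]
  simp [wDeg]

/-- Infinitesimal transport plans. The plans from `m_x^ε` to `m_y^ε` are, for small `ε`, exactly
the matrices `E_{xy} + ε • B`, so all entries of `B` are nonnegative except perhaps `B x y`. -/
structure IsRatePlan (G : SimpleGraph V) (m₁ : V → ℝ) (m₂ : Sym2 V → ℝ) (x y : V)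
    (B : V → V → ℝ) : Prop where
  nonneg : ∀ u v, ¬(u = x ∧ v = y) → 0 ≤ B u v
  source : ∀ u, ∑ v, B u v = kernelRate G m₁ m₂ x u
  target : ∀ v, ∑ u, B u v = kernelRate G m₁ m₂ y v

/-- The least cost of an infinitesimal transport plan. For small `ε` the Wasserstein distance of
`m_x^ε` and `m_y^ε` is `d x y + ε * transportRate`. -/
noncomputable def transportRate (G : SimpleGraph V) (m₁ : V → ℝ) (m₂ : Sym2 V → ℝ)
    (d : V → V → ℝ) (x y : V) : ℝ :=
  sInf {c : ℝ | ∃ B, IsRatePlan G m₁ m₂ x y B ∧ c = ∑ u, ∑ v, d u v * B u v}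

theorem IsRatePlan.swap {x y : V} {B : V → V → ℝ} (hB : IsRatePlan G m₁ m₂ x y B) :
    IsRatePlan G m₁ m₂ y x (fun u v => B v u) :=
  ⟨fun u v h => hB.nonneg v u fun h' => h h'.symm, hB.target, hB.source⟩

theorem transportRate_comm {d : V → V → ℝ} (hd : ∀ u v, d u v = d v u) (x y : V) :
    transportRate G m₁ m₂ d x y = transportRate G m₁ m₂ d y x := by
  unfold transportRate
  congr 1
  ext c
  constructor <;> rintro ⟨B, hB, rfl⟩ <;> refine ⟨_, hB.swap, ?_⟩ <;> rw [Finset.sum_comm] <;>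
    exact Finset.sum_congr rfl fun u _ => Finset.sum_congr rfl fun v _ => by rw [hd]

open Classical in
/-- The infinitesimal plan that sends the mass at the neighbours of `x` to `y`, and takes the mass
for the neighbours of `y` from `x`; the entry at `(x, y)` is then `-(Deg x + Deg y)`. It shows that
the linear program defining `transportRate` is feasible. -/
noncomputable def crossPlan (G : SimpleGraph V) (m₁ : V → ℝ) (m₂ : Sym2 V → ℝ) (x y u v : V) :
    ℝ :=
  (if v = y then kernelRate G m₁ m₂ x u else 0) + (if u = x then kernelRate G m₁ m₂ y v else 0)

theorem isRatePlan_crossPlan (hm₁ : ∀ x, 0 < m₁ x) (hm₂ : ∀ e ∈ G.edgeSet, 0 ≤ m₂ e) (x y : V) :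
    IsRatePlan G m₁ m₂ x y (crossPlan G m₁ m₂ x y) := by
  classical
  refine ⟨fun u v h => ?_, fun u => ?_, fun v => ?_⟩
  · unfold crossPlan
    by_cases hu : u = x
    · have hv : v ≠ y := fun hv => h ⟨hu, hv⟩
      simpa [hu, hv] using kernelRate_nonneg hm₁ hm₂ hv
    · by_cases hv : v = y
      · simpa [hu, hv] using kernelRate_nonneg hm₁ hm₂ hu
      · simp [hu, hv]
  · simp only [crossPlan, Finset.sum_add_distrib, Finset.sum_ite_eq', Finset.mem_univ, if_true]
    by_cases hu : u = x <;> simp [hu, sum_kernelRate]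
  · simp only [crossPlan, Finset.sum_add_distrib, Finset.sum_ite_eq', Finset.mem_univ, if_true]
    by_cases hv : v = y <;> simp [hv, sum_kernelRate]

theorem IsRatePlan.sum_eq_zero {x y : V} {B : V → V → ℝ} (hB : IsRatePlan G m₁ m₂ x y B) :
    ∑ u, ∑ v, B u v = 0 := by
  simp only [hB.source, sum_kernelRate]

/-- The unconstrained entry is bounded below by the two marginals. -/
theorem IsRatePlan.neg_le {x y : V} {B : V → V → ℝ} (hB : IsRatePlan G m₁ m₂ x y B) :
    -(wDeg G m₁ m₂ x + wDeg G m₁ m₂ y) ≤ B x y := by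
  classical
  have h1 := hB.source x
  rw [← Finset.add_sum_erase _ _ (Finset.mem_univ y), kernelRate_self] at h1
  have h2 : ∑ v ∈ Finset.univ.erase y, B x v ≤ ∑ v ∈ Finset.univ.erase y,
      kernelRate G m₁ m₂ y v := by
    refine Finset.sum_le_sum fun v hv => ?_
    rw [← hB.target v]
    exact Finset.single_le_sum (f := fun u => B u v)
      (fun u _ => hB.nonneg u v fun h => (Finset.ne_of_mem_erase hv) h.2) (Finset.mem_univ x)
  have h3 := sum_kernelRate (G := G) (m₁ := m₁) (m₂ := m₂) y
  rw [← Finset.add_sum_erase _ _ (Finset.mem_univ y), kernelRate_self] at h3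
  linarith

theorem sum_sum_ite_eq [DecidableEq V] (x y : V) (a : ℝ) :
    ∑ u, ∑ v, (if u = x ∧ v = y then a else 0) = a := by
  simp [ite_and]

theorem IsRatePlan.apply_nonpos {x y : V} {B : V → V → ℝ} (hB : IsRatePlan G m₁ m₂ x y B) :
    B x y ≤ 0 := by
  classical
  have h : ∑ u, ∑ v, (if u = x ∧ v = y then B x y else 0) ≤ ∑ u, ∑ v, B u v := by
    refine Finset.sum_le_sum fun u _ => Finset.sum_le_sum fun v _ => ?_
    split_ifs with h
    · rw [h.1, h.2]
    · exact hB.nonneg u v h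
  rwa [sum_sum_ite_eq, hB.sum_eq_zero] at h

theorem IsRatePlan.sum_abs_le {x y : V} {B : V → V → ℝ} (hB : IsRatePlan G m₁ m₂ x y B) :
    ∑ u, ∑ v, |B u v| ≤ 2 * (wDeg G m₁ m₂ x + wDeg G m₁ m₂ y) := by
  classical
  have h : ∑ u, ∑ v, |B u v| ≤ ∑ u, ∑ v, (B u v + (if u = x ∧ v = y then
      2 * (wDeg G m₁ m₂ x + wDeg G m₁ m₂ y) else 0)) := by
    refine Finset.sum_le_sum fun u _ => Finset.sum_le_sum fun v _ => ?_
    split_ifs with h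
    · rw [h.1, h.2, abs_of_nonpos hB.apply_nonpos]
      linarith [hB.neg_le]
    · rw [abs_of_nonneg (hB.nonneg u v h), add_zero]
  simpa only [Finset.sum_add_distrib, hB.sum_eq_zero, sum_sum_ite_eq, zero_add] using h

theorem IsRatePlan.le_cost {x y : V} {B : V → V → ℝ} (hB : IsRatePlan G m₁ m₂ x y B)
    {d : V → V → ℝ} (hd : ∀ u v, 0 ≤ d u v) :
    -(wDeg G m₁ m₂ x + wDeg G m₁ m₂ y) * d x y ≤ ∑ u, ∑ v, d u v * B u v := by
  classical
  have h : ∑ u, ∑ v, (if u = x ∧ v = y then -(wDeg G m₁ m₂ x + wDeg G m₁ m₂ y) * d x y else 0) ≤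
      ∑ u, ∑ v, d u v * B u v := by
    refine Finset.sum_le_sum fun u _ => Finset.sum_le_sum fun v _ => ?_
    split_ifs with h
    · rw [h.1, h.2, mul_comm]
      exact mul_le_mul_of_nonneg_left hB.neg_le (hd x y)
    · exact mul_nonneg (hd u v) (hB.nonneg u v h)
  rwa [sum_sum_ite_eq] at h

theorem transportRate_le {x y : V} {B : V → V → ℝ} (hB : IsRatePlan G m₁ m₂ x y B)
    {d : V → V → ℝ} (hd : ∀ u v, 0 ≤ d u v) :
    transportRate G m₁ m₂ d x y ≤ ∑ u, ∑ v, d u v * B u v :=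
  csInf_le ⟨_, by rintro _ ⟨B, hB, rfl⟩; exact hB.le_cost hd⟩ ⟨B, hB, rfl⟩

theorem le_transportRate (hm₁ : ∀ x, 0 < m₁ x) (hm₂ : ∀ e ∈ G.edgeSet, 0 ≤ m₂ e) {x y : V}
    {d : V → V → ℝ} {a : ℝ}
    (h : ∀ B, IsRatePlan G m₁ m₂ x y B → a ≤ ∑ u, ∑ v, d u v * B u v) :
    a ≤ transportRate G m₁ m₂ d x y :=
  le_csInf ⟨_, _, isRatePlan_crossPlan hm₁ hm₂ x y, rfl⟩ (by rintro _ ⟨B, hB, rfl⟩; exact h B hB)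

theorem neg_mul_le_transportRate (hm₁ : ∀ x, 0 < m₁ x) (hm₂ : ∀ e ∈ G.edgeSet, 0 ≤ m₂ e)
    {d : V → V → ℝ} (hd : ∀ u v, 0 ≤ d u v) (x y : V) :
    -(wDeg G m₁ m₂ x + wDeg G m₁ m₂ y) * d x y ≤ transportRate G m₁ m₂ d x y :=
  le_transportRate hm₁ hm₂ fun _ hB => hB.le_cost hd

/-- The optimal cost is Lipschitz in the cost function, since the entries of all infinitesimal
plans are uniformly bounded. -/
theorem transportRate_le_add (hm₁ : ∀ x, 0 < m₁ x) (hm₂ : ∀ e ∈ G.edgeSet, 0 ≤ m₂ e)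
    {d d' : V → V → ℝ} (hd : ∀ u v, 0 ≤ d u v) {δ : ℝ}
    (h : ∀ u v, |d u v - d' u v| ≤ δ) (x y : V) :
    transportRate G m₁ m₂ d x y ≤ transportRate G m₁ m₂ d' x y +
      2 * (wDeg G m₁ m₂ x + wDeg G m₁ m₂ y) * δ := by
  rw [← sub_le_iff_le_add]
  refine le_transportRate hm₁ hm₂ fun B hB => ?_
  rw [sub_le_iff_le_add]
  have hδ : 0 ≤ δ := (abs_nonneg _).trans (h x y)
  calc transportRate G m₁ m₂ d x y ≤ ∑ u, ∑ v, d u v * B u v := transportRate_le hB hd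
    _ ≤ ∑ u, ∑ v, (d' u v * B u v + |B u v| * δ) := by
      refine Finset.sum_le_sum fun u _ => Finset.sum_le_sum fun v _ => ?_
      have h1 : (d u v - d' u v) * B u v ≤ |B u v| * δ := by
        rw [mul_comm |B u v|]
        exact (le_abs_self _).trans ((abs_mul _ _).le.trans
          (mul_le_mul_of_nonneg_right (h u v) (abs_nonneg _)))
      linarith
    _ = ∑ u, ∑ v, d' u v * B u v + (∑ u, ∑ v, |B u v|) * δ := by
      simp only [Finset.sum_add_distrib, Finset.sum_mul]
    _ ≤ _ := by gcongr; exact hB.sum_abs_le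

theorem abs_transportRate_sub_le (hm₁ : ∀ x, 0 < m₁ x) (hm₂ : ∀ e ∈ G.edgeSet, 0 ≤ m₂ e)
    {d d' : V → V → ℝ} (hd : ∀ u v, 0 ≤ d u v) (hd' : ∀ u v, 0 ≤ d' u v) {δ : ℝ}
    (h : ∀ u v, |d u v - d' u v| ≤ δ) (x y : V) :
    |transportRate G m₁ m₂ d x y - transportRate G m₁ m₂ d' x y| ≤
      2 * (wDeg G m₁ m₂ x + wDeg G m₁ m₂ y) * δ := by
  rw [abs_sub_le_iff]
  constructor
  · linarith [transportRate_le_add hm₁ hm₂ hd h x y]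
  · linarith [transportRate_le_add hm₁ hm₂ hd' (fun u v => abs_sub_comm (d u v) _ ▸ h u v) x y]

theorem abs_transportRate_le (hm₁ : ∀ x, 0 < m₁ x) (hm₂ : ∀ e ∈ G.edgeSet, 0 ≤ m₂ e)
    {d : V → V → ℝ} (hd : ∀ u v, 0 ≤ d u v) {D : ℝ} (h : ∀ u v, d u v ≤ D) (x y : V) :
    |transportRate G m₁ m₂ d x y| ≤ 2 * (wDeg G m₁ m₂ x + wDeg G m₁ m₂ y) * D := by
  have h0 : transportRate G m₁ m₂ (fun _ _ => 0) x y = 0 := by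
    refine le_antisymm ?_ ?_
    · simpa using transportRate_le (isRatePlan_crossPlan hm₁ hm₂ x y) (d := fun _ _ => 0)
        (fun _ _ => le_rfl)
    · exact le_transportRate hm₁ hm₂ fun B _ => by simp
  have := abs_transportRate_sub_le hm₁ hm₂ hd (d' := fun _ _ => 0) (fun _ _ => le_rfl) (δ := D)
    (fun u v => by simpa [abs_of_nonneg (hd u v)] using h u v) x y
  simpa [h0] using this

open Classical in
theorem IsRatePlan.isTransportPlan
    {x y : V} {B : V → V → ℝ} (hB : IsRatePlan G m₁ m₂ x y B)
    {ε : ℝ} (hε : 0 < ε) (hε' : ε * (wDeg G m₁ m₂ x + wDeg G m₁ m₂ y) ≤ 1) :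
    IsTransportPlan (transKernel G m₁ m₂ ε x) (transKernel G m₁ m₂ ε y)
      (fun u v => (if u = x ∧ v = y then 1 else 0) + ε * B u v) := by
  have hnn : ∀ u v, 0 ≤ (if u = x ∧ v = y then (1 : ℝ) else 0) + ε * B u v := by
    intro u v
    split_ifs with h
    · rw [h.1, h.2]
      nlinarith [hB.neg_le]
    · simpa using mul_nonneg hε.le (hB.nonneg u v h)
  have hsrc : ∀ u, ∑ v, ((if u = x ∧ v = y then (1 : ℝ) else 0) + ε * B u v) =
      transKernel G m₁ m₂ ε x u := by
    intro u
    rw [transKernel_eq, Finset.sum_add_distrib, ← Finset.mul_sum, hB.source]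
    simp [ite_and]
  refine ⟨hnn, fun u v => ?_, hsrc, fun v => ?_⟩
  · -- The total mass of a plan is one.
    have htot : ∑ u, ∑ v, ((if u = x ∧ v = y then (1 : ℝ) else 0) + ε * B u v) = 1 := by
      simp only [Finset.sum_add_distrib, ← Finset.mul_sum, hB.sum_eq_zero, sum_sum_ite_eq]
      simp
    refine le_trans ?_ htot.le
    refine le_trans ?_ (Finset.single_le_sum (f := fun u => ∑ v,
      ((if u = x ∧ v = y then (1 : ℝ) else 0) + ε * B u v))
      (fun u _ => Finset.sum_nonneg fun v _ => hnn u v) (Finset.mem_univ u))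
    exact Finset.single_le_sum (f := fun v => (if u = x ∧ v = y then (1 : ℝ) else 0) + ε * B u v)
      (fun v _ => hnn u v) (Finset.mem_univ v)
  · rw [transKernel_eq, Finset.sum_add_distrib, ← Finset.mul_sum, hB.target]
    simp [ite_and]

open Classical in
theorem isRatePlan_of_isTransportPlan {x y : V} {ε : ℝ} (hε : 0 < ε) {A : V → V → ℝ}
    (hA : IsTransportPlan (transKernel G m₁ m₂ ε x) (transKernel G m₁ m₂ ε y) A) :
    IsRatePlan G m₁ m₂ x y (fun u v => (A u v - if u = x ∧ v = y then 1 else 0) / ε) := by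
  refine ⟨fun u v h => ?_, fun u => ?_, fun v => ?_⟩
  · simpa [h] using div_nonneg (hA.nonneg u v) hε.le
  · rw [← Finset.sum_div, Finset.sum_sub_distrib, hA.source, transKernel_eq]
    have : ∑ v, (if u = x ∧ v = y then (1 : ℝ) else 0) = if u = x then 1 else 0 := by
      simp [ite_and]
    rw [this]
    field_simp
    ring
  · rw [← Finset.sum_div, Finset.sum_sub_distrib, hA.target, transKernel_eq]
    have : ∑ u, (if u = x ∧ v = y then (1 : ℝ) else 0) = if v = y then 1 else 0 := by
      simp [ite_and]
    rw [this]
    field_simp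
    ring

/-- For small `ε` the Wasserstein distance is exactly affine in `ε`. -/
theorem wasserstein_transKernel (hm₁ : ∀ x, 0 < m₁ x) (hm₂ : ∀ e ∈ G.edgeSet, 0 ≤ m₂ e)
    {d : V → V → ℝ} (hd : ∀ u v, 0 ≤ d u v) (x y : V)
    {ε : ℝ} (hε : 0 < ε) (hε' : ε * (wDeg G m₁ m₂ x + wDeg G m₁ m₂ y) ≤ 1) :
    wasserstein d (transKernel G m₁ m₂ ε x) (transKernel G m₁ m₂ ε y) =
      d x y + ε * transportRate G m₁ m₂ d x y := by
  classical
  have hcost : ∀ B : V → V → ℝ, ∑ u, ∑ v, d u v * ((if u = x ∧ v = y then 1 else 0) + ε * B u v) =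
      d x y + ε * ∑ u, ∑ v, d u v * B u v := by
    intro B
    have : ∀ u v, d u v * ((if u = x ∧ v = y then 1 else 0) + ε * B u v) =
        (if u = x ∧ v = y then d x y else 0) + ε * (d u v * B u v) := by
      intro u v
      split_ifs with h
      · rw [h.1, h.2]; ring
      · ring
    simp only [this, Finset.sum_add_distrib, sum_sum_ite_eq, Finset.mul_sum]
  unfold wasserstein
  refine le_antisymm ?_ ?_
  · rw [← sub_le_iff_le_add', mul_comm, ← div_le_iff₀ hε]
    refine le_transportRate hm₁ hm₂ fun B hB => ?_
    rw [div_le_iff₀ hε, sub_le_iff_le_add', mul_comm _ ε, ← hcost]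
    refine csInf_le ⟨0, ?_⟩ ⟨_, hB.isTransportPlan hε hε', rfl⟩
    rintro _ ⟨A, hA, rfl⟩
    exact Finset.sum_nonneg fun u _ => Finset.sum_nonneg fun v _ =>
      mul_nonneg (hd u v) (hA.nonneg u v)
  · refine le_csInf ⟨_, _, (isRatePlan_crossPlan hm₁ hm₂ x y).isTransportPlan hε hε', rfl⟩ ?_
    rintro _ ⟨A, hA, rfl⟩
    have hB := isRatePlan_of_isTransportPlan hε hA
    have hAB : ∀ u v, A u v = (if u = x ∧ v = y then 1 else 0) +
        ε * ((A u v - if u = x ∧ v = y then 1 else 0) / ε) := fun u v => by field_simp; ring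
    calc d x y + ε * transportRate G m₁ m₂ d x y
        ≤ d x y + ε * ∑ u, ∑ v, d u v * ((A u v - if u = x ∧ v = y then 1 else 0) / ε) := by
          gcongr
          exact transportRate_le hB hd
      _ = ∑ u, ∑ v, d u v * A u v := by
          rw [← hcost]
          exact Finset.sum_congr rfl fun u _ => Finset.sum_congr rfl fun v _ => by rw [← hAB]

theorem tendsto_llyQuotient (hm₁ : ∀ x, 0 < m₁ x) (hm₂ : ∀ e ∈ G.edgeSet, 0 ≤ m₂ e)
    {w : Sym2 V → ℝ} (hd : ∀ u v, 0 ≤ pathDist G w u v) {x y : V} (hxy : 0 < pathDist G w x y) :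
    Tendsto (llyQuotient G m₁ m₂ w x y) (𝓝[>] 0)
      (𝓝 (-(transportRate G m₁ m₂ (pathDist G w) x y / pathDist G w x y))) := by
  have h1 : ∀ᶠ ε in 𝓝[>] (0 : ℝ), ε * (wDeg G m₁ m₂ x + wDeg G m₁ m₂ y) ≤ 1 := by
    have : Tendsto (fun ε : ℝ => ε * (wDeg G m₁ m₂ x + wDeg G m₁ m₂ y)) (𝓝[>] 0) (𝓝 0) := by
      simpa using ((continuous_id.mul continuous_const).tendsto
        (0 : ℝ)).mono_left (f := fun ε : ℝ => ε * (wDeg G m₁ m₂ x + wDeg G m₁ m₂ y))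
          nhdsWithin_le_nhds
    exact (this.eventually (eventually_lt_nhds one_pos)).mono fun _ h => h.le
  refine tendsto_const_nhds.congr' ?_
  filter_upwards [h1, self_mem_nhdsWithin] with ε hε' hε
  have hε : 0 < ε := hε
  rw [llyQuotient, wasserstein_transKernel hm₁ hm₂ hd x y hε hε']
  field_simp
  ring

end TransportRate

/-! ### The path distance -/

section PathDist

variable {V : Type*} {G : SimpleGraph V} {w w' : Sym2 V → ℝ}

@[simp]
theorem walkWeight_nil (u : V) : walkWeight w (SimpleGraph.Walk.nil : G.Walk u u) = 0 := by
  simp [walkWeight]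

@[simp]
theorem walkWeight_cons {u v x : V} (h : G.Adj u v) (p : G.Walk v x) :
    walkWeight w (.cons h p) = w s(u, v) + walkWeight w p := by
  simp [walkWeight]

theorem walkWeight_append {u v x : V} (p : G.Walk u v) (q : G.Walk v x) :
    walkWeight w (p.append q) = walkWeight w p + walkWeight w q := by
  simp [walkWeight]

theorem walkWeight_reverse {u v : V} (p : G.Walk u v) :
    walkWeight w p.reverse = walkWeight w p := by
  simp [walkWeight, List.sum_reverse]

theorem walkWeight_congr (h : ∀ e ∈ G.edgeSet, w e = w' e) {u v : V} (p : G.Walk u v) :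
    walkWeight w p = walkWeight w' p := by
  unfold walkWeight
  rw [List.map_congr_left fun e he => h e (p.edges_subset_edgeSet he)]

theorem walkWeight_nonneg (hw : ∀ e ∈ G.edgeSet, 0 ≤ w e) {u v : V} (p : G.Walk u v) :
    0 ≤ walkWeight w p := by
  refine List.sum_nonneg fun a ha => ?_
  obtain ⟨e, he, rfl⟩ := List.mem_map.1 ha
  exact hw e (p.edges_subset_edgeSet he)

theorem le_walkWeight (hw : ∀ e ∈ G.edgeSet, 0 ≤ w e) {u v : V} (p : G.Walk u v) {e : Sym2 V}
    (he : e ∈ p.edges) : w e ≤ walkWeight w p := by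
  refine List.single_le_sum (fun a ha => ?_) _ (List.mem_map.2 ⟨e, he, rfl⟩)
  obtain ⟨e, he, rfl⟩ := List.mem_map.1 ha
  exact hw e (p.edges_subset_edgeSet he)

theorem walkWeight_le_add {δ : ℝ} (h : ∀ e ∈ G.edgeSet, w e ≤ w' e + δ) {u v : V}
    (p : G.Walk u v) : walkWeight w p ≤ walkWeight w' p + p.length * δ := by
  induction p with
  | nil => simp
  | cons hA p ih =>
    have := h _ (G.mem_edgeSet.2 hA)
    simp only [walkWeight_cons, SimpleGraph.Walk.length_cons]
    push_cast
    linarith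

theorem pathDist_le (hw : ∀ e ∈ G.edgeSet, 0 ≤ w e) {u v : V} (p : G.Walk u v) :
    pathDist G w u v ≤ walkWeight w p :=
  ciInf_le ⟨0, by rintro _ ⟨p, rfl⟩; exact walkWeight_nonneg hw p⟩ p

theorem pathDist_congr (h : ∀ e ∈ G.edgeSet, w e = w' e) : pathDist G w = pathDist G w' := by
  funext u v
  unfold pathDist
  exact iInf_congr fun p => walkWeight_congr h p

theorem exists_isPath_walkWeight_eq [Finite V] (hG : G.Connected) (hw : ∀ e ∈ G.edgeSet, 0 ≤ w e)
    (u v : V) : ∃ p : G.Walk u v, p.IsPath ∧ walkWeight w p = pathDist G w u v := by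
  classical
  have := Fintype.ofFinite V
  obtain ⟨p₀⟩ := hG.preconnected u v
  have : Nonempty (G.Path u v) := ⟨p₀.toPath⟩
  obtain ⟨p, hp⟩ := Finite.exists_min fun p : G.Path u v => walkWeight w (p : G.Walk u v)
  refine ⟨p, p.2, le_antisymm ?_ (pathDist_le hw _)⟩
  have : Nonempty (G.Walk u v) := ⟨p₀⟩
  refine le_ciInf fun q => (hp ⟨q.bypass, q.bypass_isPath⟩).trans ?_
  refine List.Sublist.sum_le_sum (q.edges_bypass_sublist_edges.map w) fun a ha => ?_
  obtain ⟨e, he, rfl⟩ := List.mem_map.1 ha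
  exact hw e (q.edges_subset_edgeSet he)

theorem pathDist_nonneg (hw : ∀ e ∈ G.edgeSet, 0 ≤ w e) (u v : V) : 0 ≤ pathDist G w u v :=
  Real.iInf_nonneg fun p => walkWeight_nonneg hw p

theorem pathDist_exp_nonneg (u : Sym2 V → ℝ) (x y : V) :
    0 ≤ pathDist G (fun e => Real.exp (u e)) x y :=
  pathDist_nonneg (fun _ _ => (Real.exp_pos _).le) x y

theorem pathDist_comm (u v : V) : pathDist G w u v = pathDist G w v u := by
  unfold pathDist
  refine Function.Surjective.iInf_congr SimpleGraph.Walk.reverse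
    (fun p => ⟨p.reverse, p.reverse_reverse⟩) fun p => walkWeight_reverse p

theorem le_pathDist [Finite V] (hG : G.Connected) {a : ℝ} (ha : 0 ≤ a)
    (hw : ∀ e ∈ G.edgeSet, a ≤ w e) {u v : V} (huv : u ≠ v) : a ≤ pathDist G w u v := by
  have hw' : ∀ e ∈ G.edgeSet, 0 ≤ w e := fun e he => ha.trans (hw e he)
  obtain ⟨p, -, hp⟩ := exists_isPath_walkWeight_eq hG hw' u v
  rw [← hp]
  cases p with
  | nil => exact absurd rfl huv
  | cons h q =>
    rw [walkWeight_cons]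
    linarith [hw _ (G.mem_edgeSet.2 h), walkWeight_nonneg hw' q]

theorem pathDist_pos [Finite V] (hG : G.Connected) (hw : ∀ e ∈ G.edgeSet, 0 < w e) {u v : V}
    (huv : u ≠ v) : 0 < pathDist G w u v := by
  have hw' : ∀ e ∈ G.edgeSet, 0 ≤ w e := fun e he => (hw e he).le
  obtain ⟨p, -, hp⟩ := exists_isPath_walkWeight_eq hG hw' u v
  rw [← hp]
  cases p with
  | nil => exact absurd rfl huv
  | cons h q =>
    rw [walkWeight_cons]
    linarith [hw _ (G.mem_edgeSet.2 h), walkWeight_nonneg hw' q]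

theorem pathDist_triangle [Finite V] (hG : G.Connected) (hw : ∀ e ∈ G.edgeSet, 0 ≤ w e)
    (u v x : V) : pathDist G w u x ≤ pathDist G w u v + pathDist G w v x := by
  obtain ⟨p, -, hp⟩ := exists_isPath_walkWeight_eq hG hw u v
  obtain ⟨q, -, hq⟩ := exists_isPath_walkWeight_eq hG hw v x
  rw [← hp, ← hq, ← walkWeight_append]
  exact pathDist_le hw _

theorem pathDist_le_add [Fintype V] (hG : G.Connected) (hw : ∀ e ∈ G.edgeSet, 0 ≤ w e)
    (hw' : ∀ e ∈ G.edgeSet, 0 ≤ w' e) {δ : ℝ} (hδ : 0 ≤ δ) (h : ∀ e ∈ G.edgeSet, w e ≤ w' e + δ)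
    (u v : V) : pathDist G w u v ≤ pathDist G w' u v + Fintype.card V * δ := by
  obtain ⟨p, hpath, hp⟩ := exists_isPath_walkWeight_eq hG hw' u v
  rw [← hp]
  refine (pathDist_le hw p).trans ((walkWeight_le_add h p).trans ?_)
  gcongr
  exact hpath.length_lt.le

theorem abs_pathDist_sub_le [Fintype V] (hG : G.Connected) (hw : ∀ e ∈ G.edgeSet, 0 ≤ w e)
    (hw' : ∀ e ∈ G.edgeSet, 0 ≤ w' e) {δ : ℝ} (hδ : 0 ≤ δ)
    (h : ∀ e ∈ G.edgeSet, |w e - w' e| ≤ δ) (u v : V) :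
    |pathDist G w u v - pathDist G w' u v| ≤ Fintype.card V * δ := by
  have h1 := pathDist_le_add hG hw hw' hδ
    (fun e he => by linarith [(abs_sub_le_iff.1 (h e he)).1]) u v
  have h2 := pathDist_le_add hG hw' hw hδ
    (fun e he => by linarith [(abs_sub_le_iff.1 (h e he)).2]) u v
  rw [abs_sub_le_iff]
  constructor <;> linarith

theorem pathDist_le_card_mul [Fintype V] (hG : G.Connected) (hw : ∀ e ∈ G.edgeSet, 0 ≤ w e)
    {b : ℝ} (hb : 0 ≤ b) (h : ∀ e ∈ G.edgeSet, w e ≤ b) (u v : V) :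
    pathDist G w u v ≤ Fintype.card V * b := by
  have h0 : pathDist G (fun _ => 0) u v = 0 := by
    obtain ⟨p, -, hp⟩ := exists_isPath_walkWeight_eq (w := fun _ => 0) hG (fun _ _ => le_rfl) u v
    simp [← hp, walkWeight]
  simpa [h0] using pathDist_le_add hG hw (w' := fun _ => 0) (fun _ _ => le_rfl) hb
    (by simpa using h) u v

/-- An edge on a shortest walk is itself a shortest walk between its endpoints. -/
theorem le_pathDist_of_mem_edges [Finite V] (hG : G.Connected) (hw : ∀ e ∈ G.edgeSet, 0 ≤ w e)
    {u v : V} (p : G.Walk u v) (hp : walkWeight w p ≤ pathDist G w u v) {a b : V}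
    (hab : s(a, b) ∈ p.edges) : w s(a, b) ≤ pathDist G w a b := by
  induction p with
  | nil => simp at hab
  | @cons u v x h q ih =>
    rw [walkWeight_cons] at hp
    have h1 := pathDist_triangle hG hw u v x
    have h2 := pathDist_le hw q
    have h3 : pathDist G w u v ≤ w s(u, v) := by simpa using pathDist_le hw h.toWalk
    rw [SimpleGraph.Walk.edges_cons, List.mem_cons] at hab
    rcases hab with hab | hab
    · rw [hab]
      rcases Sym2.eq_iff.1 hab with ⟨rfl, rfl⟩ | ⟨rfl, rfl⟩
      · linarith
      · rw [pathDist_comm]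
        linarith
    · exact ih (by linarith) hab

end PathDist

/-! ### Surgery -/

section Surgery

variable {V : Type*} {G : SimpleGraph V} {w w' : Sym2 V → ℝ}

theorem surgery_le (G : SimpleGraph V) (w : Sym2 V → ℝ) : surgery G w ≤ G :=
  G.deleteEdges_le _

theorem surgery_adj {x y : V} :
    (surgery G w).Adj x y ↔ G.Adj x y ∧ ¬IsDegenerateEdge G w s(x, y) := by
  simp [surgery, SimpleGraph.deleteEdges_adj]

theorem surgery_eq_self (h : NonDegenerate G w) : surgery G w = G := by
  ext x y
  rw [surgery_adj]
  exact ⟨fun h' => h'.1, fun h' => ⟨h', h _ h'⟩⟩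

theorem surgery_lt (h : ¬NonDegenerate G w) : surgery G w < G := by
  refine (surgery_le G w).lt_of_ne fun h' => h fun e he hd => ?_
  induction e with | h x y =>
  rw [← h', SimpleGraph.mem_edgeSet, surgery_adj] at he
  exact he.2 hd

theorem IsDegenerateEdge.mono {K : SimpleGraph V} (hKG : K ≤ G) {e : Sym2 V}
    (h : IsDegenerateEdge K w e) : IsDegenerateEdge G w e := by
  obtain ⟨x, y, hA, p, rfl, hne, hle⟩ := h
  refine ⟨x, y, hKG hA, p.mapLe hKG, rfl, fun h' => hne ?_, ?_⟩
  · have h1 : p.mapLe hKG = hA.toWalk.mapLe hKG := by rw [h']; rfl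
    exact SimpleGraph.Walk.map_injective_of_injective
      (f := SimpleGraph.Hom.ofLE hKG) Function.injective_id _ _ h1
  · unfold walkWeight at hle ⊢
    simpa using hle

theorem nonDegenerate_surgery (G : SimpleGraph V) (w : Sym2 V → ℝ) :
    NonDegenerate (surgery G w) w := by
  intro e he hd
  induction e with | h x y =>
  rw [SimpleGraph.mem_edgeSet, surgery_adj] at he
  exact he.2 (hd.mono (surgery_le G w))

theorem isDegenerateEdge_congr (h : ∀ e ∈ G.edgeSet, w e = w' e) (e : Sym2 V) :
    IsDegenerateEdge G w e ↔ IsDegenerateEdge G w' e := by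
  unfold IsDegenerateEdge
  refine exists₄_congr fun x y hA p => and_congr_right fun he => ?_
  rw [walkWeight_congr h p, he, h _ hA]

theorem nonDegenerate_congr (h : ∀ e ∈ G.edgeSet, w e = w' e) :
    NonDegenerate G w ↔ NonDegenerate G w' := by
  unfold NonDegenerate
  simp only [isDegenerateEdge_congr h]

theorem surgery_congr (h : ∀ e ∈ G.edgeSet, w e = w' e) : surgery G w = surgery G w' := by
  unfold surgery
  simp only [isDegenerateEdge_congr h]

theorem lt_walkWeight_of_ne_toWalk (hw : ∀ e ∈ G.edgeSet, 0 < w e) {x y : V} (h : G.Adj x y)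
    {p : G.Walk x y} (hp : p ≠ h.toWalk) {e : Sym2 V} (he : e ∈ p.edges) :
    w e < walkWeight w p := by
  have hw' : ∀ e ∈ G.edgeSet, 0 ≤ w e := fun e he => (hw e he).le
  cases p with
  | nil => simp at he
  | cons hA q =>
    cases q with
    | nil => exact absurd rfl hp
    | cons hB r =>
      rw [SimpleGraph.Walk.edges_cons, List.mem_cons] at he
      rw [walkWeight_cons]
      rcases he with rfl | he
      · rw [walkWeight_cons]
        linarith [hw _ (G.mem_edgeSet.2 hB), walkWeight_nonneg hw' r]
      · linarith [hw _ (G.mem_edgeSet.2 hA), le_walkWeight hw' _ he]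

theorem reachable_of_forall_edges {K : SimpleGraph V} {x y : V} (p : G.Walk x y)
    (h : ∀ a b, s(a, b) ∈ p.edges → K.Reachable a b) : K.Reachable x y := by
  induction p with
  | nil => exact .refl _
  | cons hA q ih =>
    exact (h _ _ (by simp)).trans (ih fun a b hab => h a b (by simp [hab]))

/-- Surgery keeps the graph connected: a shortest edge whose endpoints were separated would be
degenerate, and the competing walk would consist of strictly shorter edges. -/
theorem connected_surgery [Finite V] (hG : G.Connected) (hw : ∀ e ∈ G.edgeSet, 0 < w e) :
    (surgery G w).Connected := by
  have key : ∀ x y, G.Adj x y → (surgery G w).Reachable x y := by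
    by_contra! hcon
    obtain ⟨x₀, y₀, hA₀, hr₀⟩ := hcon
    obtain ⟨⟨x, y⟩, ⟨hA, hr⟩, hmin⟩ := Set.exists_min_image
      {q : V × V | G.Adj q.1 q.2 ∧ ¬(surgery G w).Reachable q.1 q.2} (fun q => w s(q.1, q.2))
      (Set.toFinite _) ⟨(x₀, y₀), hA₀, hr₀⟩
    by_cases hd : IsDegenerateEdge G w s(x, y)
    · obtain ⟨a, b, hab, p, he, hne, hle⟩ := hd
      have hreach : (surgery G w).Reachable a b := by
        refine reachable_of_forall_edges p fun c d hcd => ?_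
        by_contra hcd'
        have h1 := lt_walkWeight_of_ne_toWalk hw hab hne hcd
        have h2 := hmin (c, d) ⟨p.edges_subset_edgeSet hcd, hcd'⟩
        dsimp only at h2
        linarith
      rcases Sym2.eq_iff.1 he with ⟨rfl, rfl⟩ | ⟨rfl, rfl⟩
      · exact hr hreach
      · exact hr hreach.symm
    · exact hr (surgery_adj.2 ⟨hA, hd⟩).reachable
  have := hG.nonempty
  refine ⟨fun x y => ?_⟩
  obtain ⟨p⟩ := hG.preconnected x y
  exact reachable_of_forall_edges p fun a b hab => key a b (p.edges_subset_edgeSet hab)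

/-- An edge is degenerate iff a detour through a third vertex is not longer. This replaces the
infinitely many competing walks by finitely many distances, which depend continuously on the
weight. -/
theorem nonDegenerate_iff [Finite V] (hG : G.Connected) (hw : ∀ e ∈ G.edgeSet, 0 < w e) :
    NonDegenerate G w ↔ ∀ x y z, G.Adj x y → z ≠ x → z ≠ y →
      w s(x, y) < pathDist G w x z + pathDist G w z y := by
  have hw' : ∀ e ∈ G.edgeSet, 0 ≤ w e := fun e he => (hw e he).le
  constructor
  · intro hnd x y z hA hzx hzy
    by_contra! hle
    obtain ⟨p, -, hp⟩ := exists_isPath_walkWeight_eq hG hw' x z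
    obtain ⟨q, -, hq⟩ := exists_isPath_walkWeight_eq hG hw' z y
    refine hnd _ (G.mem_edgeSet.2 hA) ⟨x, y, hA, p.append q, rfl, fun h => ?_, ?_⟩
    · have hz : z ∈ (p.append q).support := by simp [SimpleGraph.Walk.mem_support_append_iff]
      rw [h] at hz
      simp [hzx, hzy] at hz
    · rwa [walkWeight_append, hp, hq]
  · rintro h e - ⟨x, y, hA, p, rfl, hne, hle⟩
    cases p with
    | nil => exact hA.ne rfl
    | @cons _ z _ hB q =>
      have hzy : z ≠ y := by
        rintro rfl
        cases q with
        | nil => exact hne rfl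
        | cons hC r =>
          rw [walkWeight_cons, walkWeight_cons] at hle
          linarith [hw _ (G.mem_edgeSet.2 hC), walkWeight_nonneg hw' r]
      have h1 := h x y z hA hB.ne' hzy
      have h2 : pathDist G w x z ≤ w s(x, z) := by simpa using pathDist_le hw' hB.toWalk
      have h3 := pathDist_le hw' q
      rw [walkWeight_cons] at hle
      linarith

end Surgery

/-! ### Continuous dependence on the weight -/

section Continuity

variable {V : Type*} [Fintype V] {G : SimpleGraph V} {w : Sym2 V → ℝ} {α : Type*} {l : Filter α}
  {f : α → Sym2 V → ℝ}

theorem tendsto_pathDist (hG : G.Connected) (hw : ∀ e ∈ G.edgeSet, 0 < w e)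
    (hf : ∀ e ∈ G.edgeSet, Tendsto (fun s => f s e) l (𝓝 (w e))) (x y : V) :
    Tendsto (fun s => pathDist G (f s) x y) l (𝓝 (pathDist G w x y)) := by
  have hfin : G.edgeSet.Finite := Set.toFinite _
  have hpos : ∀ᶠ s in l, ∀ e ∈ G.edgeSet, 0 < f s e :=
    (Filter.eventually_all_finite hfin).2 fun e he =>
      (hf e he).eventually (eventually_gt_nhds (hw e he))
  rw [Metric.tendsto_nhds]
  intro ε hε
  obtain ⟨δ, hδ, hδε⟩ : ∃ δ > 0, Fintype.card V * δ < ε := by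
    refine ⟨ε / (Fintype.card V + 1), by positivity, ?_⟩
    rw [mul_div_assoc', div_lt_iff₀ (by positivity)]
    linarith
  have hclose : ∀ᶠ s in l, ∀ e ∈ G.edgeSet, |f s e - w e| ≤ δ :=
    (Filter.eventually_all_finite hfin).2 fun e he =>
      ((Metric.tendsto_nhds.1 (hf e he)) δ hδ).mono fun s hs => by
        rw [Real.dist_eq] at hs
        exact hs.le
  filter_upwards [hpos, hclose] with s hs1 hs2
  exact (abs_pathDist_sub_le hG (fun e he => (hs1 e he).le) (fun e he => (hw e he).le) hδ.le hs2
    x y).trans_lt hδε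

theorem eventually_nonDegenerate (hG : G.Connected) (hw : ∀ e ∈ G.edgeSet, 0 < w e)
    (hf : ∀ e ∈ G.edgeSet, Tendsto (fun s => f s e) l (𝓝 (w e))) (hnd : NonDegenerate G w) :
    ∀ᶠ s in l, NonDegenerate G (f s) := by
  have hpos : ∀ᶠ s in l, ∀ e ∈ G.edgeSet, 0 < f s e :=
    (Filter.eventually_all_finite (Set.toFinite _)).2 fun e he =>
      (hf e he).eventually (eventually_gt_nhds (hw e he))
  rw [nonDegenerate_iff hG hw] at hnd
  have h : ∀ᶠ s in l, ∀ x y z, G.Adj x y → z ≠ x → z ≠ y →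
      f s s(x, y) < pathDist G (f s) x z + pathDist G (f s) z y := by
    simp only [Filter.eventually_all]
    intro x y z hA hzx hzy
    exact (hf _ (G.mem_edgeSet.2 hA)).eventually_lt
      ((tendsto_pathDist hG hw hf x z).add (tendsto_pathDist hG hw hf z y)) (hnd x y z hA hzx hzy)
  filter_upwards [hpos, h] with s hs1 hs2
  exact (nonDegenerate_iff hG hs1).2 hs2

end Continuity

/-! ### The curvature in terms of the optimal infinitesimal cost -/

section Curvature

variable {V : Type*} [Fintype V] {G : SimpleGraph V} {m₁ : V → ℝ} {m₂ w w' : Sym2 V → ℝ}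

theorem llyCurvature_congr (h : ∀ e ∈ G.edgeSet, w e = w' e) :
    llyCurvature G m₁ m₂ w = llyCurvature G m₁ m₂ w' := by
  funext x y
  unfold llyCurvature llyQuotient
  rw [pathDist_congr h]

theorem tendsto_llyQuotient_of_pos (hG : G.Connected) (hm₁ : ∀ x, 0 < m₁ x)
    (hm₂ : ∀ e ∈ G.edgeSet, 0 ≤ m₂ e) (hw : ∀ e ∈ G.edgeSet, 0 < w e) {x y : V} (hxy : x ≠ y) :
    Tendsto (llyQuotient G m₁ m₂ w x y) (𝓝[>] 0)
      (𝓝 (-(transportRate G m₁ m₂ (pathDist G w) x y / pathDist G w x y))) :=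
  tendsto_llyQuotient hm₁ hm₂ (pathDist_nonneg fun e he => (hw e he).le) (pathDist_pos hG hw hxy)

theorem llyCurvature_eq (hG : G.Connected) (hm₁ : ∀ x, 0 < m₁ x)
    (hm₂ : ∀ e ∈ G.edgeSet, 0 ≤ m₂ e) (hw : ∀ e ∈ G.edgeSet, 0 < w e) {x y : V} (hxy : x ≠ y) :
    llyCurvature G m₁ m₂ w x y =
      -(transportRate G m₁ m₂ (pathDist G w) x y / pathDist G w x y) :=
  (tendsto_llyQuotient_of_pos hG hm₁ hm₂ hw hxy).limUnder_eq

end Curvature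

/-! ### Auxiliary facts from real analysis -/

section RealAnalysis

/-- Real induction on a closed interval. -/
theorem forall_mem_Icc_of_left_right {P : ℝ → Prop} {a b : ℝ} (h0 : P a)
    (hright : ∀ t, a ≤ t → t < b → P t → ∀ᶠ s in 𝓝[>] t, P s)
    (hleft : ∀ t, a < t → t ≤ b → (∀ s, a ≤ s → s < t → P s) → P t) :
    ∀ t ∈ Icc a b, P t := by
  by_contra! hcon
  obtain ⟨t₀, ht₀, hPt₀⟩ := hcon
  set S : Set ℝ := {t | t ∈ Icc a b ∧ ¬P t} with hS
  have hSne : S.Nonempty := ⟨t₀, ht₀, hPt₀⟩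
  have hSbdd : BddBelow S := ⟨a, fun t ht => ht.1.1⟩
  have h1 : a ≤ sInf S := le_csInf hSne fun t ht => ht.1.1
  have h2 : sInf S ≤ t₀ := csInf_le hSbdd ⟨ht₀, hPt₀⟩
  have hbelow : ∀ s, a ≤ s → s < sInf S → P s := by
    intro s hs hs'
    by_contra hPs
    exact absurd (csInf_le hSbdd ⟨⟨hs, hs'.le.trans (h2.trans ht₀.2)⟩, hPs⟩) (not_le.2 hs')
  have hP : P (sInf S) := by
    rcases h1.eq_or_lt with h | h
    · rwa [← h]
    · exact hleft _ h (h2.trans ht₀.2) hbelow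
  have hlt : sInf S < t₀ := h2.lt_of_ne fun h => hPt₀ (h ▸ hP)
  obtain ⟨c, hc, hcP⟩ := mem_nhdsGT_iff_exists_Ioo_subset.1
    (hright _ h1 (hlt.trans_le ht₀.2) hP)
  have hc' : sInf S < c := hc
  obtain ⟨s, hs, hsc⟩ := exists_lt_of_csInf_lt hSne hc'
  have hs1 : sInf S < s := (csInf_le hSbdd hs).lt_of_ne fun h => hs.2 (h ▸ hP)
  exact hs.2 (hcP ⟨hs1, hsc⟩)

theorem eventually_pos_of_hasDerivAt {φ : ℝ → ℝ} {φ' t : ℝ} (h : HasDerivAt φ φ' t) (hφ' : 0 < φ')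
    (h0 : 0 ≤ φ t) : ∀ᶠ s in 𝓝[>] t, 0 < φ s := by
  have h1 := (hasDerivAt_iff_tendsto_slope.1 h).mono_left
    (nhdsWithin_mono t (fun s hs => ne_of_gt hs : Ioi t ⊆ {t}ᶜ))
  filter_upwards [h1.eventually (eventually_gt_nhds hφ'), self_mem_nhdsWithin] with s hs hts
  rw [slope_def_field] at hs
  have hts' : 0 < s - t := sub_pos.2 hts
  have := (div_pos_iff_of_pos_right hts').1 hs
  linarith

theorem abs_div_sub_div_le {p q p' q' a N η θ : ℝ} (ha : 0 < a) (hq : a ≤ q) (hq' : a ≤ q')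
    (hp' : |p'| ≤ N) (hη : |p - p'| ≤ η) (hθ : |q - q'| ≤ θ) :
    |p / q - p' / q'| ≤ η / a + N * θ / a ^ 2 := by
  have hq0 : 0 < q := ha.trans_le hq
  have hq0' : 0 < q' := ha.trans_le hq'
  have hN : 0 ≤ N := (abs_nonneg _).trans hp'
  have h1 : p / q - p' / q' = (p - p') / q + p' * (q' - q) / (q * q') := by
    field_simp
    ring
  rw [h1]
  refine (abs_add_le _ _).trans (add_le_add ?_ ?_)
  · rw [abs_div, abs_of_pos hq0]
    exact div_le_div₀ ((abs_nonneg _).trans hη) hη ha hq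
  · rw [abs_div, abs_mul, abs_of_pos (mul_pos hq0 hq0'), abs_sub_comm q' q]
    refine div_le_div₀ (mul_nonneg hN ((abs_nonneg _).trans hθ))
      (mul_le_mul hp' hθ (abs_nonneg _) hN) (by positivity) ?_
    rw [sq]
    exact mul_le_mul hq hq' ha.le hq0.le

theorem abs_exp_sub_exp_le {x y R : ℝ} (hx : x ≤ R) (hy : y ≤ R) :
    |Real.exp x - Real.exp y| ≤ Real.exp R * |x - y| := by
  have := (convex_Iic R).norm_image_sub_le_of_norm_deriv_le (f := Real.exp) (C := Real.exp R)
    (fun z _ => Real.differentiableAt_exp)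
    (fun z hz => by
      rw [Real.deriv_exp, Real.norm_eq_abs, Real.abs_exp]
      exact Real.exp_le_exp.2 hz) (mem_Iic.2 hy) (mem_Iic.2 hx)
  simpa [Real.norm_eq_abs] using this

end RealAnalysis

/-! ### The flow in logarithmic coordinates -/

section LogField

variable {V : Type*} [Fintype V] {G : SimpleGraph V} {m₁ : V → ℝ} {m₂ : Sym2 V → ℝ}

/-- A constant that dominates `2 (Deg x + Deg y)` for all `x`, `y`. -/
noncomputable def degBound (G : SimpleGraph V) (m₁ : V → ℝ) (m₂ : Sym2 V → ℝ) : ℝ :=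
  4 * ∑ x, wDeg G m₁ m₂ x

theorem wDeg_add_wDeg_le (hm₁ : ∀ x, 0 < m₁ x) (hm₂ : ∀ e ∈ G.edgeSet, 0 ≤ m₂ e) (x y : V) :
    2 * (wDeg G m₁ m₂ x + wDeg G m₁ m₂ y) ≤ degBound G m₁ m₂ := by
  have h : ∀ x, wDeg G m₁ m₂ x ≤ ∑ x, wDeg G m₁ m₂ x := fun x =>
    Finset.single_le_sum (f := wDeg G m₁ m₂) (fun x _ => wDeg_nonneg hm₁ hm₂ x)
      (Finset.mem_univ x)
  unfold degBound
  linarith [h x, h y]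

theorem degBound_nonneg (hm₁ : ∀ x, 0 < m₁ x) (hm₂ : ∀ e ∈ G.edgeSet, 0 ≤ m₂ e) :
    0 ≤ degBound G m₁ m₂ :=
  mul_nonneg (by norm_num) (Finset.sum_nonneg fun x _ => wDeg_nonneg hm₁ hm₂ x)

open Classical in
/-- The vector field of the flow for the logarithms `u = log ω` of the edge weights, which is
`-κ = c / d` with the optimal cost `c` and the distance `d` of the endpoints. The numerator is cut
off at `M` and the denominator at `a`; this makes the field bounded, and a priori estimates show
that for suitable `a` and `M` the cut-offs are not active. Off the edges of `G` the field is
zero. -/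
noncomputable def logField (G : SimpleGraph V) (m₁ : V → ℝ) (m₂ : Sym2 V → ℝ) (a M : ℝ)
    (u : Sym2 V → ℝ) (e : Sym2 V) : ℝ :=
  if e ∈ G.edgeSet then
    Sym2.lift ⟨fun x y =>
      min (transportRate G m₁ m₂ (pathDist G fun e => Real.exp (u e)) x y) M /
        max (pathDist G (fun e => Real.exp (u e)) x y) a, fun x y => by
          dsimp only
          rw [transportRate_comm pathDist_comm, pathDist_comm x y]⟩ e
  else 0

theorem logField_of_adj {a M : ℝ} {u : Sym2 V → ℝ} {x y : V} (h : G.Adj x y) :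
    logField G m₁ m₂ a M u s(x, y) =
      min (transportRate G m₁ m₂ (pathDist G fun e => Real.exp (u e)) x y) M /
        max (pathDist G (fun e => Real.exp (u e)) x y) a := by
  simp [logField, h]

theorem logField_of_notMem {a M : ℝ} {u : Sym2 V → ℝ} {e : Sym2 V} (h : e ∉ G.edgeSet) :
    logField G m₁ m₂ a M u e = 0 :=
  if_neg h

theorem transportRate_le_degBound_mul (hm₁ : ∀ x, 0 < m₁ x) (hm₂ : ∀ e ∈ G.edgeSet, 0 ≤ m₂ e)
    {u : Sym2 V → ℝ} {D : ℝ} (hD : ∀ x y, pathDist G (fun e => Real.exp (u e)) x y ≤ D)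
    (x y : V) :
    |transportRate G m₁ m₂ (pathDist G fun e => Real.exp (u e)) x y| ≤ degBound G m₁ m₂ * D := by
  refine (abs_transportRate_le hm₁ hm₂ (pathDist_exp_nonneg u) hD x y).trans ?_
  have : 0 ≤ D := (pathDist_exp_nonneg u x y).trans (hD x y)
  gcongr
  exact wDeg_add_wDeg_le hm₁ hm₂ x y

theorem logField_eq_neg_llyCurvature (hG : G.Connected) (hm₁ : ∀ x, 0 < m₁ x)
    (hm₂ : ∀ e ∈ G.edgeSet, 0 ≤ m₂ e) {a M D : ℝ} {u : Sym2 V → ℝ} (ha : 0 ≤ a)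
    (hu : ∀ e ∈ G.edgeSet, a ≤ Real.exp (u e))
    (hD : ∀ x y, pathDist G (fun e => Real.exp (u e)) x y ≤ D) (hM : degBound G m₁ m₂ * D ≤ M)
    {x y : V} (h : G.Adj x y) :
    logField G m₁ m₂ a M u s(x, y) =
      -llyCurvature G m₁ m₂ (fun e => Real.exp (u e)) x y := by
  rw [logField_of_adj h, llyCurvature_eq hG hm₁ hm₂ (fun _ _ => Real.exp_pos _) h.ne, neg_neg,
    min_eq_left, max_eq_left (le_pathDist hG ha hu h.ne)]
  exact (le_abs_self _).trans ((transportRate_le_degBound_mul hm₁ hm₂ hD x y).trans hM)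

theorem neg_degBound_le_logField (hm₁ : ∀ x, 0 < m₁ x)
    (hm₂ : ∀ e ∈ G.edgeSet, 0 ≤ m₂ e) {a M : ℝ} (ha : 0 < a) (hM : 0 ≤ M) (u : Sym2 V → ℝ)
    (e : Sym2 V) : -degBound G m₁ m₂ ≤ logField G m₁ m₂ a M u e := by
  have hS := degBound_nonneg hm₁ hm₂
  by_cases he : e ∈ G.edgeSet
  · induction e with | h x y =>
    rw [logField_of_adj he, le_div_iff₀ (lt_max_of_lt_right ha)]
    have hd := pathDist_exp_nonneg (G := G) u x y
    have h1 := neg_mul_le_transportRate hm₁ hm₂ (pathDist_exp_nonneg (G := G) u) x y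
    have h2 := wDeg_add_wDeg_le hm₁ hm₂ x y
    have h3 := wDeg_nonneg hm₁ hm₂ x
    have h4 := wDeg_nonneg hm₁ hm₂ y
    have h5 := le_max_left (pathDist G (fun e => Real.exp (u e)) x y) a
    refine le_min (le_trans ?_ h1) ?_
    · rw [neg_mul, neg_mul, neg_le_neg_iff]
      exact mul_le_mul (by linarith) h5 hd hS
    · refine le_trans ?_ hM
      rw [neg_mul, neg_nonpos]
      exact mul_nonneg hS (hd.trans h5)
  · rw [logField_of_notMem he]
    linarith

theorem logField_le {a M : ℝ} (ha : 0 < a) (hM : 0 ≤ M) (u : Sym2 V → ℝ)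
    (e : Sym2 V) : logField G m₁ m₂ a M u e ≤ M / a := by
  by_cases he : e ∈ G.edgeSet
  · induction e with | h x y =>
    rw [logField_of_adj he]
    exact div_le_div₀ hM (min_le_right _ _) ha (le_max_right _ _)
  · rw [logField_of_notMem he]
    positivity

theorem norm_logField_le [DecidableEq V] (hm₁ : ∀ x, 0 < m₁ x)
    (hm₂ : ∀ e ∈ G.edgeSet, 0 ≤ m₂ e) {a M : ℝ} (ha : 0 < a) (hM : 0 ≤ M) (u : Sym2 V → ℝ) :
    ‖logField G m₁ m₂ a M u‖ ≤ degBound G m₁ m₂ + M / a := by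
  have hS := degBound_nonneg hm₁ hm₂
  have hMa : 0 ≤ M / a := by positivity
  refine (pi_norm_le_iff_of_nonneg (by positivity)).2 fun e => ?_
  rw [Real.norm_eq_abs, abs_le]
  constructor
  · linarith [neg_degBound_le_logField hm₁ hm₂ ha hM u e]
  · linarith [logField_le (G := G) (m₁ := m₁) (m₂ := m₂) ha hM u e]

theorem exists_lipschitzOnWith_logField [DecidableEq V] (hG : G.Connected) (hm₁ : ∀ x, 0 < m₁ x)
    (hm₂ : ∀ e ∈ G.edgeSet, 0 ≤ m₂ e) {a : ℝ} (ha : 0 < a) (M R : ℝ) :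
    ∃ K, LipschitzOnWith K (logField G m₁ m₂ a M) (Metric.closedBall 0 R) := by
  set S := degBound G m₁ m₂ with hS_def
  have hS : 0 ≤ S := degBound_nonneg hm₁ hm₂
  set L : ℝ := Fintype.card V * Real.exp R with hL_def
  have hL : 0 ≤ L := by positivity
  set N : ℝ := S * L + |M| with hN_def
  have hN : 0 ≤ N := by positivity
  refine ⟨Real.toNNReal (S * L / a + N * L / a ^ 2), LipschitzOnWith.of_dist_le_mul ?_⟩
  intro u hu u' hu'
  rw [Real.coe_toNNReal _ (by positivity)]
  have hbd : ∀ v ∈ Metric.closedBall (0 : Sym2 V → ℝ) R, ∀ e, v e ≤ R := by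
    intro v hv e
    rw [mem_closedBall_zero_iff] at hv
    exact (le_abs_self _).trans ((norm_le_pi_norm v e).trans hv)
  have hd : ∀ x y, |pathDist G (fun e => Real.exp (u e)) x y -
      pathDist G (fun e => Real.exp (u' e)) x y| ≤ L * dist u u' := by
    intro x y
    rw [hL_def, mul_assoc]
    refine abs_pathDist_sub_le hG (fun _ _ => (Real.exp_pos _).le)
      (fun _ _ => (Real.exp_pos _).le) (by positivity) (fun e _ => ?_) x y
    refine (abs_exp_sub_exp_le (hbd u hu e) (hbd u' hu' e)).trans ?_
    gcongr
    exact dist_le_pi_dist u u' e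
  refine (dist_pi_le_iff (by positivity)).2 fun e => ?_
  by_cases he : e ∈ G.edgeSet
  · induction e with | h x y =>
    rw [logField_of_adj he, logField_of_adj he, Real.dist_eq]
    have hc : |transportRate G m₁ m₂ (pathDist G fun e => Real.exp (u e)) x y -
        transportRate G m₁ m₂ (pathDist G fun e => Real.exp (u' e)) x y| ≤
          S * (L * dist u u') := by
      refine (abs_transportRate_sub_le hm₁ hm₂ (pathDist_exp_nonneg u) (pathDist_exp_nonneg u') hd
        x y).trans ?_
      gcongr
      exact wDeg_add_wDeg_le hm₁ hm₂ x y
    have hc' := transportRate_le_degBound_mul hm₁ hm₂ (u := u') (D := L)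
      (fun x y => pathDist_le_card_mul hG (fun _ _ => (Real.exp_pos _).le) (Real.exp_pos _).le
        (fun e _ => Real.exp_le_exp.2 (hbd u' hu' e)) x y) x y
    have hbound := abs_div_sub_div_le (a := a) (N := N) (η := S * (L * dist u u'))
      (θ := L * dist u u') ha
      (le_max_right (pathDist G (fun e => Real.exp (u e)) x y) a)
      (le_max_right (pathDist G (fun e => Real.exp (u' e)) x y) a)
      (p := min (transportRate G m₁ m₂ (pathDist G fun e => Real.exp (u e)) x y) M)
      (p' := min (transportRate G m₁ m₂ (pathDist G fun e => Real.exp (u' e)) x y) M)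
      (abs_min_le_max_abs_abs.trans (max_le_add_of_nonneg (abs_nonneg _) (abs_nonneg _) |>.trans
        (add_le_add_left hc' _)))
      ((abs_min_sub_min_le_max _ _ _ _).trans (max_le hc
        (by simpa using (by positivity : 0 ≤ S * (L * dist u u')))))
      ((abs_max_sub_max_le_max _ _ _ _).trans (max_le (hd x y)
        (by simpa using (by positivity : 0 ≤ L * dist u u'))))
    refine hbound.trans (le_of_eq ?_)
    ring
  · rw [logField_of_notMem he, logField_of_notMem he, dist_self]
    positivity

theorem exists_hasDerivAt_logField [DecidableEq V] (hG : G.Connected) (hm₁ : ∀ x, 0 < m₁ x)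
    (hm₂ : ∀ e ∈ G.edgeSet, 0 ≤ m₂ e) {a M : ℝ} (ha : 0 < a) (hM : 0 ≤ M) (T : ℝ)
    (u₀ : Sym2 V → ℝ) :
    ∃ u : ℝ → Sym2 V → ℝ, u 0 = u₀ ∧
      ∀ t ∈ Icc 0 T, HasDerivAt u (logField G m₁ m₂ a M (u t)) t := by
  rcases lt_or_ge T 0 with hT | hT
  · exact ⟨fun _ => u₀, rfl, fun t ht => absurd (ht.1.trans ht.2) (not_le.2 hT)⟩
  have hS := degBound_nonneg hm₁ hm₂
  have hL : 0 ≤ degBound G m₁ m₂ + M / a := by positivity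
  set L : NNReal := ⟨degBound G m₁ m₂ + M / a, hL⟩ with hL_def
  set r : NNReal := L * ⟨T + 1, by linarith⟩ with hr_def
  obtain ⟨K, hK⟩ := exists_lipschitzOnWith_logField hG hm₁ hm₂ ha M (‖u₀‖ + r)
  have hsub : Metric.closedBall u₀ r ⊆ Metric.closedBall 0 (‖u₀‖ + r) := by
    intro v hv
    rw [mem_closedBall_zero_iff]
    rw [mem_closedBall_iff_norm] at hv
    have := norm_add_le u₀ (v - u₀)
    rw [add_sub_cancel] at this
    linarith
  have hPL : IsPicardLindelof (fun _ : ℝ => logField G m₁ m₂ a M) (tmin := -(T + 1))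
      (tmax := T + 1) ⟨0, by constructor <;> linarith⟩ u₀ r 0 L K := by
    refine ⟨fun _ _ => hK.mono hsub, fun _ _ => continuousOn_const,
      fun _ _ u _ => norm_logField_le hm₁ hm₂ ha hM u, ?_⟩
    have hmax : max (T + 1 - 0) (0 - -(T + 1)) = T + 1 := by simp
    change (L : ℝ) * max (T + 1 - 0) (0 - -(T + 1)) ≤ (L : ℝ) * (T + 1) - 0
    rw [hmax, sub_zero]
  obtain ⟨u, hu0, hu⟩ := hPL.exists_eq_forall_mem_Icc_hasDerivWithinAt₀
  refine ⟨u, hu0, fun t ht => (hu t ⟨?_, ?_⟩).hasDerivAt (Icc_mem_nhds ?_ ?_)⟩ <;>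
    linarith [ht.1, ht.2]

end LogField

/-! ### A priori estimates -/

section Walks

variable {V : Type*} {G : SimpleGraph V}

theorem hasDerivAt_walkWeight_exp {u : ℝ → Sym2 V → ℝ} {u' : Sym2 V → ℝ} {t : ℝ}
    (h : ∀ e, HasDerivAt (fun s => u s e) (u' e) t) {x y : V} (p : G.Walk x y) :
    HasDerivAt (fun s => walkWeight (fun e => Real.exp (u s e)) p)
      (walkWeight (fun e => Real.exp (u t e) * u' e) p) t := by
  induction p with
  | nil => simpa using hasDerivAt_const t (0 : ℝ)
  | cons hA p ih =>
    simp only [walkWeight_cons]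
    exact (h _).exp.add ih

theorem walkWeight_le_length_mul {w : Sym2 V → ℝ} {x y : V} (p : G.Walk x y) {b : ℝ}
    (h : ∀ e ∈ p.edges, w e ≤ b) : walkWeight w p ≤ p.length * b := by
  induction p with
  | nil => simp
  | cons hA p ih =>
    have h1 := h _ (SimpleGraph.Walk.edges_cons hA p ▸ List.mem_cons_self)
    have h2 := ih fun e he => h e (by simp [he])
    simp only [walkWeight_cons, SimpleGraph.Walk.length_cons]
    push_cast
    linarith

open Classical in
/-- The logarithms of the edge weights, extended by zero off the edges. -/
noncomputable def logWeight (G : SimpleGraph V) (w : Sym2 V → ℝ) (e : Sym2 V) : ℝ :=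
  if e ∈ G.edgeSet then Real.log (w e) else 0

theorem exp_logWeight {w : Sym2 V → ℝ} (hw : ∀ e ∈ G.edgeSet, 0 < w e) {e : Sym2 V}
    (he : e ∈ G.edgeSet) : Real.exp (logWeight G w e) = w e := by
  rw [logWeight, if_pos he, Real.exp_log (hw e he)]

end Walks

section APriori

variable {V : Type*} [Fintype V] {G : SimpleGraph V} {m₁ : V → ℝ} {m₂ : Sym2 V → ℝ}

/-- Along a solution the logarithmic weights decrease at most linearly. -/
theorem sub_le_of_hasDerivAt_logField [DecidableEq V] (hm₁ : ∀ x, 0 < m₁ x)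
    (hm₂ : ∀ e ∈ G.edgeSet, 0 ≤ m₂ e) {a M T : ℝ} (ha : 0 < a) (hM : 0 ≤ M)
    {u : ℝ → Sym2 V → ℝ}
    (hu : ∀ t ∈ Icc 0 T, HasDerivAt u (logField G m₁ m₂ a M (u t)) t) {t : ℝ} (ht : t ∈ Icc 0 T)
    (e : Sym2 V) : u 0 e - degBound G m₁ m₂ * t ≤ u t e := by
  have hd : ∀ s ∈ Icc 0 T, HasDerivAt (fun s => u s e) (logField G m₁ m₂ a M (u s) e) s :=
    fun s hs => hasDerivAt_pi.1 (hu s hs) e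
  have := (convex_Icc 0 T).mul_sub_le_image_sub_of_le_deriv (f := fun s => u s e)
    (C := -degBound G m₁ m₂)
    (fun s hs => (hd s hs).continuousAt.continuousWithinAt)
    (fun s hs => (hd s (interior_subset hs)).differentiableAt.differentiableWithinAt)
    (fun s hs => by
      rw [(hd s (interior_subset hs)).deriv]
      exact neg_degBound_le_logField hm₁ hm₂ ha hM _ e)
    0 ⟨le_rfl, ht.1.trans ht.2⟩ t ht ht.1
  simp only [sub_zero] at this
  linarith

/-- Along a solution the distances grow at most exponentially: a shortest path consists of edges
that realize the distance of their endpoints, and the weight of such an edge grows at a rate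
bounded by the diameter. -/
theorem pathDist_le_of_hasDerivAt_logField [DecidableEq V] (hG : G.Connected)
    (hm₁ : ∀ x, 0 < m₁ x) (hm₂ : ∀ e ∈ G.edgeSet, 0 ≤ m₂ e) {a M T A : ℝ} (ha : 0 < a)
    (hA : 0 < A) {u : ℝ → Sym2 V → ℝ}
    (hu : ∀ t ∈ Icc 0 T, HasDerivAt u (logField G m₁ m₂ a M (u t)) t)
    (hlow : ∀ t ∈ Icc 0 T, ∀ e ∈ G.edgeSet, a ≤ Real.exp (u t e))
    (h0 : ∀ x y, pathDist G (fun e => Real.exp (u 0 e)) x y ≤ A) :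
    ∀ t ∈ Icc 0 T, ∀ x y, pathDist G (fun e => Real.exp (u t e)) x y ≤
      A * Real.exp ((Fintype.card V * degBound G m₁ m₂ + 1) * t) := by
  set S := degBound G m₁ m₂ with hS_def
  have hS : 0 ≤ S := degBound_nonneg hm₁ hm₂
  set k : ℝ := Fintype.card V * S + 1 with hk_def
  have hnn : ∀ t, ∀ e ∈ G.edgeSet, 0 ≤ Real.exp (u t e) := fun _ _ _ => (Real.exp_pos _).le
  refine forall_mem_Icc_of_left_right (by simpa using h0) ?_ ?_
  · intro t ht0 htT ht
    have htI : t ∈ Icc 0 T := ⟨ht0, htT.le⟩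
    set D := A * Real.exp (k * t) with hD_def
    have hD : 0 < D := by positivity
    simp only [Filter.eventually_all]
    intro x y
    obtain ⟨p, hpath, hp⟩ := exists_isPath_walkWeight_eq hG (hnn t) x y
    have hder1 := hasDerivAt_walkWeight_exp (fun e => hasDerivAt_pi.1 (hu t htI) e) p
    have hder2 : HasDerivAt (fun s => A * Real.exp (k * s)) (A * (Real.exp (k * t) * k)) t := by
      have := ((hasDerivAt_id t).const_mul k).exp.const_mul A
      simpa using this
    have hrate : walkWeight (fun e => Real.exp (u t e) * logField G m₁ m₂ a M (u t) e) p ≤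
        Fintype.card V * (S * D) := by
      refine (walkWeight_le_length_mul p (b := S * D) fun e he => ?_).trans
        (by gcongr; exact hpath.length_lt.le)
      have heG := p.edges_subset_edgeSet he
      induction e with | h b c =>
      have hbc : G.Adj b c := heG
      have hd := le_pathDist_of_mem_edges hG (hnn t) p hp.le he
      have hpos := pathDist_pos (w := fun e => Real.exp (u t e)) hG
        (fun _ _ => Real.exp_pos _) hbc.ne
      rw [logField_of_adj hbc, max_eq_left (le_pathDist hG ha.le (hlow t htI) hbc.ne),
        mul_div_assoc', div_le_iff₀ hpos]
      have hc := (min_le_left _ M).trans ((le_abs_self _).trans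
        (transportRate_le_degBound_mul hm₁ hm₂ ht b c))
      calc _ ≤ Real.exp (u t s(b, c)) * (S * D) := by gcongr
        _ ≤ pathDist G (fun e => Real.exp (u t e)) b c * (S * D) := by gcongr
        _ = _ := mul_comm _ _
    have hpos := eventually_pos_of_hasDerivAt (hder2.sub hder1)
      (by
        have : A * (Real.exp (k * t) * k) = Fintype.card V * (S * D) + D := by
          rw [hD_def, hk_def]; ring
        linarith)
      (by
        have := ht x y
        simp only [Pi.sub_apply]
        linarith)
    filter_upwards [hpos] with s hs
    simp only [Pi.sub_apply] at hs
    exact (pathDist_le (hnn s) p).trans (by linarith)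
  · intro t ht0 htT ht x y
    have hcont : ∀ e ∈ G.edgeSet,
        Tendsto (fun s => Real.exp (u s e)) (𝓝[<] t) (𝓝 (Real.exp (u t e))) := fun e _ =>
      ((hasDerivAt_pi.1 (hu t ⟨ht0.le, htT⟩) e).exp.continuousAt.tendsto).mono_left
        nhdsWithin_le_nhds
    have hcont2 : Tendsto (fun s => A * Real.exp (k * s)) (𝓝[<] t) (𝓝 (A * Real.exp (k * t))) :=
      (Continuous.tendsto (by fun_prop) t).mono_left nhdsWithin_le_nhds
    refine le_of_tendsto_of_tendsto
      (tendsto_pathDist hG (fun _ _ => Real.exp_pos _) hcont x y) hcont2 ?_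
    filter_upwards [Ioo_mem_nhdsLT ht0] with s hs
    exact ht s hs.1.le hs.2 x y

end APriori

/-! ### The flow on a fixed graph -/

section Flow

variable {V : Type*} [Fintype V] {G : SimpleGraph V} {m₁ : V → ℝ} {m₂ : Sym2 V → ℝ}
  {w₀ : Sym2 V → ℝ} {ω ω' : ℝ → Sym2 V → ℝ}

/-- `ω` is a positive solution of the flow on the fixed graph `G` over the interval `[a,b]`. -/
structure IsFlowOn (G : SimpleGraph V) (m₁ : V → ℝ) (m₂ : Sym2 V → ℝ) (a b : ℝ)
    (ω : ℝ → Sym2 V → ℝ) : Prop where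
  pos : ∀ t ∈ Icc a b, ∀ e ∈ G.edgeSet, 0 < ω t e
  cont : ∀ e ∈ G.edgeSet, ContinuousWithinAt (fun s => ω s e) (Ici a) a
  deriv : ∀ t ∈ Ioc a b, ∀ x y : V, G.Adj x y →
    HasDerivAt (fun s => ω s s(x, y)) (-(llyCurvature G m₁ m₂ (ω t) x y) * ω t s(x, y)) t

theorem IsFlowOn.continuousOn_logWeight {a b : ℝ} (h : IsFlowOn G m₁ m₂ a b ω) :
    ContinuousOn (fun t => logWeight G (ω t)) (Icc a b) := by
  classical
  refine continuousOn_pi.2 fun e t ht => ?_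
  by_cases he : e ∈ G.edgeSet
  · simp only [logWeight, if_pos he]
    refine ContinuousWithinAt.log ?_ (h.pos t ht e he).ne'
    rcases ht.1.eq_or_lt with rfl | hat
    · exact (h.cont e he).mono Icc_subset_Ici_self
    · induction e with | h x y =>
      exact (h.deriv t ⟨hat, ht.2⟩ x y he).continuousAt.continuousWithinAt
  · simp only [logWeight, if_neg he]
    exact continuousWithinAt_const

theorem IsFlowOn.hasDerivAt_logWeight [DecidableEq V] (hG : G.Connected) (hm₁ : ∀ x, 0 < m₁ x)
    (hm₂ : ∀ e ∈ G.edgeSet, 0 ≤ m₂ e) {a b R : ℝ} (h : IsFlowOn G m₁ m₂ a b ω)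
    {t : ℝ} (ht : t ∈ Ioc a b) (hR : ‖logWeight G (ω t)‖ ≤ R) :
    HasDerivAt (fun t => logWeight G (ω t)) (logField G m₁ m₂ (Real.exp (-R))
      (degBound G m₁ m₂ * (Fintype.card V * Real.exp R)) (logWeight G (ω t))) t := by
  refine hasDerivAt_pi.2 fun e => ?_
  by_cases he : e ∈ G.edgeSet
  · induction e with | h x y =>
    have htI : t ∈ Icc a b := ⟨ht.1.le, ht.2⟩
    have hbd : ∀ e, |logWeight G (ω t) e| ≤ R := fun e =>
      (norm_le_pi_norm (logWeight G (ω t)) e).trans hR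
    rw [logField_eq_neg_llyCurvature hG hm₁ hm₂ (D := Fintype.card V * Real.exp R)
      (Real.exp_pos _).le (fun e _ => Real.exp_le_exp.2 (abs_le.1 (hbd e)).1)
      (pathDist_le_card_mul hG (fun _ _ => (Real.exp_pos _).le) (Real.exp_pos _).le
        fun e _ => Real.exp_le_exp.2 (abs_le.1 (hbd e)).2) le_rfl he,
      llyCurvature_congr (w' := ω t) fun e he => exp_logWeight (h.pos t htI) he]
    have hpos := h.pos t htI _ he
    have h1 := (h.deriv t ht x y he).log hpos.ne'
    rw [mul_div_cancel_right₀ _ hpos.ne'] at h1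
    simpa only [logWeight, if_pos he] using h1
  · rw [logField_of_notMem he]
    simpa only [logWeight, if_neg he] using hasDerivAt_const t (0 : ℝ)

/-- Solutions on a fixed graph are unique. -/
theorem IsFlowOn.eq_right (hG : G.Connected) (hm₁ : ∀ x, 0 < m₁ x)
    (hm₂ : ∀ e ∈ G.edgeSet, 0 ≤ m₂ e) {a b : ℝ} (hab : a ≤ b) (h : IsFlowOn G m₁ m₂ a b ω)
    (h' : IsFlowOn G m₁ m₂ a b ω') (h0 : ∀ e ∈ G.edgeSet, ω a e = ω' a e) :
    ∀ e ∈ G.edgeSet, ω b e = ω' b e := by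
  classical
  rcases hab.eq_or_lt with rfl | hab
  · exact h0
  obtain ⟨R₁, hR₁⟩ := isCompact_Icc.exists_bound_of_continuousOn h.continuousOn_logWeight
  obtain ⟨R₂, hR₂⟩ := isCompact_Icc.exists_bound_of_continuousOn h'.continuousOn_logWeight
  set R := max R₁ R₂ with hR_def
  have hR : ∀ t ∈ Icc a b, ‖logWeight G (ω t)‖ ≤ R := fun t ht =>
    (hR₁ t ht).trans (le_max_left _ _)
  have hR' : ∀ t ∈ Icc a b, ‖logWeight G (ω' t)‖ ≤ R := fun t ht =>
    (hR₂ t ht).trans (le_max_right _ _)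
  obtain ⟨K, hK⟩ := exists_lipschitzOnWith_logField hG hm₁ hm₂ (Real.exp_pos (-R))
    (degBound G m₁ m₂ * (Fintype.card V * Real.exp R)) R
  -- The equation holds only after time `a`, so Gronwall's inequality is applied on `[c,b]`.
  have hgron : ∀ c ∈ Ioo a b, dist (logWeight G (ω b)) (logWeight G (ω' b)) ≤
      dist (logWeight G (ω c)) (logWeight G (ω' c)) * Real.exp (K * (b - c)) := by
    intro c hc
    have hsub : Icc c b ⊆ Icc a b := Icc_subset_Icc_left hc.1.le
    exact dist_le_of_trajectories_ODE_of_mem (v := fun _ => logField G m₁ m₂ (Real.exp (-R))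
      (degBound G m₁ m₂ * (Fintype.card V * Real.exp R))) (s := fun _ => Metric.closedBall 0 R)
      (f := fun t => logWeight G (ω t)) (g := fun t => logWeight G (ω' t))
      (fun _ _ => hK) (h.continuousOn_logWeight.mono hsub)
      (fun t ht => (h.hasDerivAt_logWeight hG hm₁ hm₂ ⟨hc.1.trans_le ht.1, ht.2.le⟩
        (hR t (hsub (Ico_subset_Icc_self ht)))).hasDerivWithinAt)
      (fun t ht => mem_closedBall_zero_iff.2 (hR t (hsub (Ico_subset_Icc_self ht))))
      (h'.continuousOn_logWeight.mono hsub)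
      (fun t ht => (h'.hasDerivAt_logWeight hG hm₁ hm₂ ⟨hc.1.trans_le ht.1, ht.2.le⟩
        (hR' t (hsub (Ico_subset_Icc_self ht)))).hasDerivWithinAt)
      (fun t ht => mem_closedBall_zero_iff.2 (hR' t (hsub (Ico_subset_Icc_self ht)))) le_rfl b
      ⟨hc.2.le, le_rfl⟩
  have hlim : Tendsto (fun c => dist (logWeight G (ω c)) (logWeight G (ω' c)) *
      Real.exp (K * (b - c))) (𝓝[>] a) (𝓝 0) := by
    have h1 : Tendsto (fun c => logWeight G (ω c)) (𝓝[>] a) (𝓝 (logWeight G (ω a))) :=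
      ((h.continuousOn_logWeight a ⟨le_rfl, hab.le⟩).mono_of_mem_nhdsWithin
        (Icc_mem_nhdsGT hab)).tendsto
    have h2 : Tendsto (fun c => logWeight G (ω' c)) (𝓝[>] a) (𝓝 (logWeight G (ω' a))) :=
      ((h'.continuousOn_logWeight a ⟨le_rfl, hab.le⟩).mono_of_mem_nhdsWithin
        (Icc_mem_nhdsGT hab)).tendsto
    have h3 : Tendsto (fun c => Real.exp (K * (b - c))) (𝓝[>] a) (𝓝 (Real.exp (K * (b - a)))) :=
      (Continuous.tendsto (by fun_prop) a).mono_left nhdsWithin_le_nhds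
    have h4 : logWeight G (ω a) = logWeight G (ω' a) := by
      funext e
      unfold logWeight
      split_ifs with he
      · rw [h0 e he]
      · rfl
    simpa [h4] using (h1.dist h2).mul h3
  have hzero : dist (logWeight G (ω b)) (logWeight G (ω' b)) ≤ 0 := by
    refine ge_of_tendsto hlim ?_
    filter_upwards [Ioo_mem_nhdsGT hab] with c hc
    exact hgron c hc
  have heq : logWeight G (ω b) = logWeight G (ω' b) := dist_le_zero.1 hzero
  intro e he
  rw [← exp_logWeight (h.pos b ⟨hab.le, le_rfl⟩) he, heq,
    exp_logWeight (h'.pos b ⟨hab.le, le_rfl⟩) he]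

theorem IsFlow.isFlowOn {T : EReal} (h : IsFlow G m₁ m₂ w₀ T ω) {t : ℝ}
    (htT : (t : EReal) < T) : IsFlowOn G m₁ m₂ 0 t ω := by
  have hlt : ∀ s ≤ t, (s : EReal) < T := fun s hs => (EReal.coe_le_coe_iff.2 hs).trans_lt htT
  exact ⟨fun s hs => h.pos s hs.1 (hlt s hs.2), h.cont_zero,
    fun s hs => h.deriv s hs.1 (hlt s hs.2)⟩

theorem IsFlow.eq_of_lt (hG : G.Connected) (hm₁ : ∀ x, 0 < m₁ x)
    (hm₂ : ∀ e ∈ G.edgeSet, 0 ≤ m₂ e) {T T' : EReal} (h : IsFlow G m₁ m₂ w₀ T ω)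
    (h' : IsFlow G m₁ m₂ w₀ T' ω') {t : ℝ} (ht : 0 ≤ t) (htT : (t : EReal) < T)
    (htT' : (t : EReal) < T') : ∀ e ∈ G.edgeSet, ω t e = ω' t e :=
  (h.isFlowOn htT).eq_right hG hm₁ hm₂ ht (h'.isFlowOn htT') fun e he => by
    rw [h.init e he, h'.init e he]

/-- The flow exists on every bounded time interval. -/
theorem exists_isFlow_coe (hG : G.Connected) (hm₁ : ∀ x, 0 < m₁ x)
    (hm₂ : ∀ e ∈ G.edgeSet, 0 ≤ m₂ e) (hw₀ : ∀ e ∈ G.edgeSet, 0 < w₀ e) {T : ℝ} (hT : 0 ≤ T) :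
    ∃ ω, IsFlow G m₁ m₂ w₀ (T : EReal) ω := by
  classical
  set S := degBound G m₁ m₂ with hS_def
  have hS : 0 ≤ S := degBound_nonneg hm₁ hm₂
  set u₀ := logWeight G w₀ with hu₀_def
  -- The constants of the two cut-offs come from the a priori estimates on `[0,T]`.
  set a := Real.exp (-‖u₀‖ - S * T) with ha_def
  have ha : 0 < a := Real.exp_pos _
  set A := (Fintype.card V + 1) * Real.exp ‖u₀‖ with hA_def
  have hA : 0 < A := by positivity
  set k : ℝ := Fintype.card V * S + 1 with hk_def
  have hk : 0 ≤ k := by positivity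
  set M := S * (A * Real.exp (k * T)) with hM_def
  have hM : 0 ≤ M := by positivity
  obtain ⟨u, hu0, hu⟩ := exists_hasDerivAt_logField hG hm₁ hm₂ ha hM T u₀
  have hlow : ∀ t ∈ Icc 0 T, ∀ e ∈ G.edgeSet, a ≤ Real.exp (u t e) := by
    intro t ht e _
    have h1 := sub_le_of_hasDerivAt_logField hm₁ hm₂ ha hM hu ht e
    rw [hu0] at h1
    have h2 := (abs_le.1 (norm_le_pi_norm u₀ e)).1
    have h3 : S * t ≤ S * T := mul_le_mul_of_nonneg_left ht.2 hS
    exact Real.exp_le_exp.2 (by linarith)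
  have h0 : ∀ x y, pathDist G (fun e => Real.exp (u 0 e)) x y ≤ A := by
    intro x y
    rw [hu0]
    refine (pathDist_le_card_mul hG (fun _ _ => (Real.exp_pos _).le) (Real.exp_pos ‖u₀‖).le
      (fun e _ => Real.exp_le_exp.2 ((le_abs_self _).trans (norm_le_pi_norm u₀ e))) x y).trans ?_
    rw [hA_def]
    gcongr
    linarith
  have hup := pathDist_le_of_hasDerivAt_logField hG hm₁ hm₂ ha hA hu hlow h0
  refine ⟨fun t e => Real.exp (u t e), ⟨fun e he => ?_, fun _ _ _ _ _ => Real.exp_pos _,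
    fun e _ => ?_, fun t ht0 htT x y hxy => ?_⟩⟩
  · rw [hu0, hu₀_def, exp_logWeight hw₀ he]
  · exact (hasDerivAt_pi.1 (hu 0 ⟨le_rfl, hT⟩) e).exp.continuousAt.continuousWithinAt
  · have htI : t ∈ Icc 0 T := ⟨ht0.le, (EReal.coe_lt_coe_iff.1 htT).le⟩
    have h1 := (hasDerivAt_pi.1 (hu t htI) s(x, y)).exp
    have hMle : S * (A * Real.exp (k * t)) ≤ M := by
      rw [hM_def]
      gcongr
      exact htI.2
    rw [logField_eq_neg_llyCurvature hG hm₁ hm₂ ha.le (hlow t htI) (hup t htI) hMle hxy] at h1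
    rwa [mul_comm]

theorem exists_isFlow_top (hG : G.Connected) (hm₁ : ∀ x, 0 < m₁ x)
    (hm₂ : ∀ e ∈ G.edgeSet, 0 ≤ m₂ e) (hw₀ : ∀ e ∈ G.edgeSet, 0 < w₀ e) :
    ∃ ω, IsFlow G m₁ m₂ w₀ ⊤ ω := by
  have hex : ∀ n : ℕ, ∃ ω, IsFlow G m₁ m₂ w₀ ((n : ℝ) : EReal) ω := fun n =>
    exists_isFlow_coe hG hm₁ hm₂ hw₀ n.cast_nonneg
  choose W hW using hex
  have hlt : ∀ t : ℝ, (t : EReal) < (((⌊t⌋₊ + 1 : ℕ) : ℝ) : EReal) := fun t =>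
    EReal.coe_lt_coe_iff.2 (by push_cast; exact Nat.lt_floor_add_one t)
  set ω : ℝ → Sym2 V → ℝ := fun t => W (⌊t⌋₊ + 1) t with hω
  have heq : ∀ n : ℕ, ∀ t : ℝ, 0 ≤ t → t < n → ∀ e ∈ G.edgeSet, ω t e = W n t e :=
    fun n t ht htn => (hW _).eq_of_lt hG hm₁ hm₂ (hW n) ht (hlt t) (EReal.coe_lt_coe_iff.2 htn)
  refine ⟨ω, fun e he => ?_, fun t ht _ e he => (hW _).pos t ht (hlt t) e he, fun e he => ?_,
    fun t ht _ x y hxy => ?_⟩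
  · exact (hW _).init e he
  · refine ((hW 1).cont_zero e he).congr_of_eventuallyEq ?_ (heq 1 0 le_rfl (by simp) e he)
    filter_upwards [Ico_mem_nhdsGE (zero_lt_one' ℝ)] with s hs
    exact heq 1 s hs.1 (by simpa using hs.2) e he
  · have h1 := (hW (⌊t⌋₊ + 1)).deriv t ht (hlt t) x y hxy
    refine h1.congr_of_eventuallyEq ?_
    filter_upwards [Ioo_mem_nhds ht (EReal.coe_lt_coe_iff.1 (hlt t))] with s hs
    exact heq _ s hs.1.le hs.2 _ hxy

theorem IsFlow.congr {T : EReal} (h : IsFlow G m₁ m₂ w₀ T ω)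
    (heq : ∀ t, ∀ e ∈ G.edgeSet, ω' t e = ω t e) : IsFlow G m₁ m₂ w₀ T ω' := by
  refine ⟨fun e he => ?_, fun t h0 hT e he => ?_, fun e he => ?_, fun t h0 hT x y hxy => ?_⟩
  · rw [heq 0 e he, h.init e he]
  · rw [heq t e he]
    exact h.pos t h0 hT e he
  · simpa only [heq _ e he] using h.cont_zero e he
  · rw [llyCurvature_congr (heq t), heq t _ hxy]
    simpa only [heq _ _ (G.mem_edgeSet.2 hxy)] using h.deriv t h0 hT x y hxy

end Flow

/-! ### The flow with surgery -/

section SurgeryFlow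

variable {V : Type*} [Fintype V] {G : SimpleGraph V} {m₁ : V → ℝ} {m₂ : Sym2 V → ℝ}
  {w₀ : Sym2 V → ℝ} {H H' : ℝ → SimpleGraph V} {ω ω' : ℝ → Sym2 V → ℝ}

theorem IsSurgeryFlow.isFlowOn {T : EReal} (h : IsSurgeryFlow G m₁ m₂ w₀ T H ω) {t s u : ℝ}
    (ht : 0 ≤ t) (hts : t ≤ s) (hsT : (s : EReal) < T) (hsu : s < u)
    (hconst : ∀ r ∈ Ico t u, H r = H t) : IsFlowOn (H t) m₁ m₂ t s ω := by
  have hlt : ∀ r ≤ s, (r : EReal) < T := fun r hr => (EReal.coe_le_coe_iff.2 hr).trans_lt hsT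
  refine ⟨fun r hr e he => ?_, (h.right t ht (hlt t hts)).2, fun r hr x y hxy => ?_⟩
  · rw [← hconst r ⟨hr.1, hr.2.trans_lt hsu⟩] at he
    exact h.pos r (ht.trans hr.1) (hlt r hr.2) e he
  · have hr' : H r = H t := hconst r ⟨hr.1.le, hr.2.trans_lt hsu⟩
    rw [← hr'] at hxy ⊢
    refine h.deriv r (ht.trans_lt hr.1) (hlt r hr.2) ?_ x y hxy
    filter_upwards [Ioo_mem_nhds hr.1 (hr.2.trans_lt hsu)] with q hq
    rw [hr', hconst q ⟨hq.1.le, hq.2⟩]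

/-- Flows with surgery are unique: agreement propagates to the right by uniqueness on a fixed
graph, and to a surgery time because the surgery is determined by the limiting weights. -/
theorem IsSurgeryFlow.eq_of_lt (hG : G.Connected) (hm₁ : ∀ x, 0 < m₁ x)
    (hm₂ : ∀ e ∈ G.edgeSet, 0 ≤ m₂ e) (hw₀ : ∀ e ∈ G.edgeSet, 0 < w₀ e) {T T' : EReal}
    (h : IsSurgeryFlow G m₁ m₂ w₀ T H ω) (h' : IsSurgeryFlow G m₁ m₂ w₀ T' H' ω') {t : ℝ}
    (ht : 0 ≤ t) (htT : (t : EReal) < T) (htT' : (t : EReal) < T') :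
    H' t = H t ∧ ∀ e ∈ (H t).edgeSet, ω' t e = ω t e := by
  have hlt : ∀ r ≤ t, (r : EReal) < T := fun r hr => (EReal.coe_le_coe_iff.2 hr).trans_lt htT
  have hlt' : ∀ r ≤ t, (r : EReal) < T' := fun r hr => (EReal.coe_le_coe_iff.2 hr).trans_lt htT'
  have key := forall_mem_Icc_of_left_right (a := 0) (b := t)
    (P := fun t => (H' t = H t ∧ ∀ e ∈ (H t).edgeSet, ω' t e = ω t e) ∧
      (H t).Connected ∧ H t ≤ G) ?_ ?_ ?_
  · exact (key t ⟨ht, le_rfl⟩).1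
  · rw [h.init_graph, h'.init_graph]
    refine ⟨⟨rfl, fun e he => ?_⟩, connected_surgery hG hw₀, surgery_le G w₀⟩
    have heG := SimpleGraph.edgeSet_mono (surgery_le G w₀) he
    rw [h.init e heG, h'.init e heG]
  · rintro r hr0 hrt ⟨⟨hH, hω⟩, hconn, hle⟩
    obtain ⟨u, hu, hconst⟩ := mem_nhdsGE_iff_exists_Ico_subset.1
      ((h.right r hr0 (hlt r hrt.le)).1.and (h'.right r hr0 (hlt' r hrt.le)).1)
    have hmin : r < min u t := lt_min hu hrt
    filter_upwards [Ioo_mem_nhdsGT hmin] with s hs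
    have hsu : s < u := hs.2.trans_le (min_le_left _ _)
    have hst : s ≤ t := hs.2.le.trans (min_le_right _ _)
    have hf := h.isFlowOn hr0 hs.1.le (hlt s hst) hsu fun q hq => (hconst hq).1
    have hf' := h'.isFlowOn hr0 hs.1.le (hlt' s hst) hsu fun q hq => (hconst hq).2
    have hs1 : H s = H r := (hconst ⟨hs.1.le, hsu⟩).1
    have hs2 : H' s = H' r := (hconst ⟨hs.1.le, hsu⟩).2
    rw [hs1, hs2]
    rw [hH] at hf'
    exact ⟨⟨hH, hf'.eq_right hconn hm₁ (fun e he => hm₂ e (SimpleGraph.edgeSet_mono hle he))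
      hs.1.le hf hω⟩, hconn, hle⟩
  · intro r hr0 hrt hprev
    obtain ⟨K, hK, hKω, hKH⟩ := h.left r hr0 (hlt r hrt)
    obtain ⟨K', hK', hKω', hKH'⟩ := h'.left r hr0 (hlt' r hrt)
    have hprev' : ∀ᶠ s in 𝓝[<] r, (H' s = H s ∧ ∀ e ∈ (H s).edgeSet, ω' s e = ω s e) ∧
        (H s).Connected ∧ H s ≤ G := by
      filter_upwards [Ioo_mem_nhdsLT hr0] with s hs
      exact hprev s hs.1.le hs.2
    obtain ⟨s, hsK, hsK', ⟨hsH, -⟩, hconn, hle⟩ := (hK.and (hK'.and hprev')).exists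
    rw [hsK, hsK'] at hsH
    rw [hsK] at hconn hle
    subst hsH
    have hω : ∀ e ∈ K'.edgeSet, ω r e = ω' r e := by
      intro e he
      have h1 := ((hKω e he).2.mono Iio_subset_Iic_self).tendsto
      have h2 := ((hKω' e he).2.mono Iio_subset_Iic_self).tendsto
      refine tendsto_nhds_unique (h1.congr' ?_) h2
      filter_upwards [hK, hprev'] with q hq hq'
      exact (hq'.1.2 e (hq ▸ he)).symm
    rw [hKH, hKH', surgery_congr hω]
    exact ⟨⟨rfl, fun e he => (hω e (SimpleGraph.edgeSet_mono (surgery_le _ _) he)).symm⟩,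
      connected_surgery hconn fun e he => (hKω' e he).1, (surgery_le _ _).trans hle⟩

theorem IsFlow.continuousAt {T : EReal} (h : IsFlow G m₁ m₂ w₀ T ω) {t : ℝ} (ht : 0 < t)
    (htT : (t : EReal) < T) {e : Sym2 V} (he : e ∈ G.edgeSet) :
    ContinuousAt (fun s => ω s e) t := by
  induction e with | h x y =>
  exact (h.deriv t ht htT x y he).continuousAt

theorem IsFlow.continuousWithinAt_Ici {T : EReal} (h : IsFlow G m₁ m₂ w₀ T ω) {t : ℝ}
    (ht : 0 ≤ t) (htT : (t : EReal) < T) {e : Sym2 V} (he : e ∈ G.edgeSet) :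
    ContinuousWithinAt (fun s => ω s e) (Ici t) t := by
  rcases ht.eq_or_lt with rfl | ht
  · exact h.cont_zero e he
  · exact (h.continuousAt ht htT he).continuousWithinAt

/-- A flow on `surgery G w₀` along which no edge becomes degenerate needs no further surgery. -/
theorem IsFlow.isSurgeryFlow (h : IsFlow (surgery G w₀) m₁ m₂ w₀ ⊤ ω) (h0 : ω 0 = w₀)
    (hnd : ∀ t, 0 ≤ t → NonDegenerate (surgery G w₀) (ω t)) :
    IsSurgeryFlow G m₁ m₂ w₀ ⊤ (fun _ => surgery G w₀) ω where
  init e _ := by rw [h0]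
  init_graph := rfl
  pos := h.pos
  nonDegenerate t ht _ := hnd t ht
  right t ht hT := ⟨Eventually.of_forall fun _ => rfl,
    fun _ he => h.continuousWithinAt_Ici ht hT he⟩
  left t ht hT := ⟨surgery G w₀, Eventually.of_forall fun _ => rfl,
    fun e he => ⟨h.pos t ht.le hT e he, (h.continuousAt ht hT he).continuousWithinAt⟩,
    (surgery_eq_self (hnd t ht.le)).symm⟩
  deriv t ht hT _ := h.deriv t ht hT

/-- A flow on `surgery G w₀` up to the first time `τ` at which an edge becomes degenerate can be
continued by a flow with surgery started at time `τ`. -/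
theorem IsFlow.isSurgeryFlow_glue {τ : ℝ} (hτ : 0 < τ) (h : IsFlow (surgery G w₀) m₁ m₂ w₀ ⊤ ω)
    (h0 : ω 0 = w₀) (hnd : ∀ t, 0 ≤ t → t < τ → NonDegenerate (surgery G w₀) (ω t))
    (hd : ¬NonDegenerate (surgery G w₀) (ω τ))
    (h' : IsSurgeryFlow (surgery G w₀) m₁ m₂ (ω τ) ⊤ H' ω') :
    IsSurgeryFlow G m₁ m₂ w₀ ⊤ (fun t => if t < τ then surgery G w₀ else H' (t - τ))
      (fun t => if t ≤ τ then ω t else ω' (t - τ)) := by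
  set K := surgery G w₀ with hK
  have hsub : surgery K (ω τ) ≤ K := surgery_le _ _
  have hH0 : H' (τ - τ) = surgery K (ω τ) := by rw [sub_self, h'.init_graph]
  -- From time `τ` on, the weights of the current edges are those of the second flow.
  have hω' : ∀ t, τ ≤ t → ∀ e ∈ (H' (t - τ)).edgeSet, ∀ s, t ≤ s →
      (if s ≤ τ then ω s else ω' (s - τ)) e = ω' (s - τ) e := by
    intro t ht e he s hs
    split_ifs with hsτ
    · obtain rfl : t = τ := le_antisymm (hs.trans hsτ) ht
      obtain rfl : s = t := le_antisymm hsτ hs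
      rw [hH0] at he
      rw [sub_self, h'.init e (SimpleGraph.edgeSet_mono hsub he)]
    · rfl
  have hshift : ∀ (t : ℝ) (S S' : Set ℝ), MapsTo (fun s => s - τ) S S' →
      Tendsto (fun s => s - τ) (𝓝[S] t) (𝓝[S'] (t - τ)) := fun t S S' hS =>
    ((continuous_sub_right τ).continuousWithinAt).tendsto_nhdsWithin hS
  have hMLt : ∀ t, MapsTo (fun s => s - τ) (Iio t) (Iio (t - τ)) := fun t s hs =>
    sub_lt_sub_right (mem_Iio.1 hs) τ
  have hMLe : ∀ t, MapsTo (fun s => s - τ) (Iic t) (Iic (t - τ)) := fun t s hs =>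
    sub_le_sub_right (mem_Iic.1 hs) τ
  have hMGe : ∀ t, MapsTo (fun s => s - τ) (Ici t) (Ici (t - τ)) := fun t s hs =>
    sub_le_sub_right (mem_Ici.1 hs) τ
  refine ⟨fun e he => ?_, ?_, fun t ht hT e he => ?_, fun t ht hT => ?_, fun t ht hT => ?_,
    fun t ht hT => ?_, fun t ht hT hev x y hxy => ?_⟩
  · rw [if_pos hτ.le, h0]
  · rw [if_pos hτ]
  · rcases lt_or_ge t τ with htτ | htτ
    · rw [if_pos htτ] at he
      rw [if_pos htτ.le]
      exact h.pos t ht hT e he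
    · rw [if_neg htτ.not_gt] at he
      rw [hω' t htτ e he t le_rfl]
      exact h'.pos (t - τ) (sub_nonneg.2 htτ) (EReal.coe_lt_top _) e he
  · rcases lt_or_ge t τ with htτ | htτ
    · rw [if_pos htτ, if_pos htτ.le]
      exact hnd t ht htτ
    · rw [if_neg htτ.not_gt]
      rw [nonDegenerate_congr fun e he => hω' t htτ e he t le_rfl]
      exact h'.nonDegenerate (t - τ) (sub_nonneg.2 htτ) (EReal.coe_lt_top _)
  · rcases lt_or_ge t τ with htτ | htτ
    · rw [if_pos htτ]
      have hnear : ∀ᶠ s in 𝓝[≥] t, s < τ := eventually_nhdsWithin_of_eventually_nhds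
        (eventually_lt_nhds htτ)
      refine ⟨hnear.mono fun s hs => if_pos hs, fun e he => ?_⟩
      refine (h.continuousWithinAt_Ici ht hT he).congr_of_eventuallyEq
        (hnear.mono fun s hs => ?_) ?_
      · simp only [if_pos hs.le]
      · rw [if_pos htτ.le]
    · rw [if_neg htτ.not_gt]
      obtain ⟨h1, h2⟩ := h'.right (t - τ) (sub_nonneg.2 htτ) (EReal.coe_lt_top _)
      refine ⟨?_, fun e he => ?_⟩
      · filter_upwards [(hshift t _ _ (hMGe t)).eventually h1, self_mem_nhdsWithin] with s hs hts
        rw [if_neg (htτ.trans hts).not_gt, hs]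
      · have h3 : Tendsto (fun s => ω' (s - τ) e) (𝓝[≥] t) (𝓝 (ω' (t - τ) e)) :=
          (h2 e he).tendsto.comp (hshift t _ _ (hMGe t))
        exact ContinuousWithinAt.congr h3 (fun s hs => hω' t htτ e he s hs)
          (hω' t htτ e he t le_rfl)
  · rcases le_or_gt t τ with htτ | htτ
    · refine ⟨K, ?_, fun e he => ⟨?_, ?_⟩, ?_⟩
      · filter_upwards [self_mem_nhdsWithin] with s hs
        exact if_pos (lt_of_lt_of_le hs htτ)
      · rw [if_pos htτ]
        exact h.pos t ht.le hT e he
      · refine (h.continuousAt ht hT he).continuousWithinAt.congr (fun s hs => ?_) ?_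
        · rw [if_pos ((mem_Iic.1 hs).trans htτ)]
        · rw [if_pos htτ]
      · rw [if_pos htτ]
        rcases htτ.eq_or_lt with rfl | htτ
        · rw [if_neg (lt_irrefl _), hH0]
        · rw [if_pos htτ, surgery_eq_self (hnd t ht.le htτ)]
    · obtain ⟨L, h1, h2, h3⟩ := h'.left (t - τ) (sub_pos.2 htτ) (EReal.coe_lt_top _)
      have hnear : ∀ S : Set ℝ, ∀ᶠ s in 𝓝[S] t, τ < s := fun S =>
        eventually_nhdsWithin_of_eventually_nhds (eventually_gt_nhds htτ)
      rw [if_neg htτ.not_gt, if_neg htτ.not_ge]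
      refine ⟨L, ?_, fun e he => ⟨(h2 e he).1, ?_⟩, h3⟩
      · filter_upwards [(hshift t _ _ (hMLt t)).eventually h1, hnear (Iio t)] with s hs hts
        rw [if_neg hts.not_gt, hs]
      · have h4 : Tendsto (fun s => ω' (s - τ) e) (𝓝[≤] t) (𝓝 (ω' (t - τ) e)) :=
          (h2 e he).2.tendsto.comp (hshift t _ _ (hMLe t))
        refine ContinuousWithinAt.congr_of_eventuallyEq h4 ((hnear (Iic t)).mono fun s hs => ?_) ?_
        · simp only [if_neg hs.not_ge]
        · rw [if_neg htτ.not_ge]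
  · rcases lt_trichotomy t τ with htτ | rfl | htτ
    · rw [if_pos htτ] at hxy ⊢
      rw [if_pos htτ.le]
      refine (h.deriv t ht hT x y hxy).congr_of_eventuallyEq ?_
      filter_upwards [eventually_lt_nhds htτ] with s hs
      rw [if_pos hs.le]
    · -- The graph changes at time `τ`, so there is nothing to show.
      exfalso
      obtain ⟨s, hs, hst⟩ := ((hev.filter_mono nhdsWithin_le_nhds).and
        (self_mem_nhdsWithin : Iio t ∈ 𝓝[<] t)).exists
      rw [if_pos (mem_Iio.1 hst), if_neg (lt_irrefl _), hH0] at hs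
      exact (surgery_lt hd).ne hs.symm
    · rw [if_neg htτ.not_gt] at hxy ⊢
      rw [if_neg htτ.not_ge]
      have hev' : ∀ᶠ s in 𝓝 (t - τ), H' s = H' (t - τ) := by
        have hcont : Tendsto (fun s => s + τ) (𝓝 (t - τ)) (𝓝 t) := by
          simpa using (continuous_add_const τ).tendsto (t - τ)
        filter_upwards [hcont.eventually hev, hcont.eventually (eventually_gt_nhds htτ)]
          with s hs hts
        rwa [if_neg hts.not_gt, if_neg htτ.not_gt, add_sub_cancel_right] at hs
      have h1 := h'.deriv (t - τ) (sub_pos.2 htτ) (EReal.coe_lt_top _) hev' x y hxy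
      refine (h1.comp_sub_const t τ).congr_of_eventuallyEq ?_
      filter_upwards [eventually_gt_nhds htτ] with s hs
      rw [if_neg hs.not_ge]

/-- Existence of the flow with surgery, by induction on the number of edges that survive the
surgery at time zero. -/
theorem exists_isSurgeryFlow (hG : G.Connected) (hm₁ : ∀ x, 0 < m₁ x)
    (hm₂ : ∀ e ∈ G.edgeSet, 0 ≤ m₂ e) (hw₀ : ∀ e ∈ G.edgeSet, 0 < w₀ e) :
    ∃ H ω, IsSurgeryFlow G m₁ m₂ w₀ ⊤ H ω := by
  induction hn : (surgery G w₀).edgeSet.ncard using Nat.strong_induction_on generalizing G w₀ with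
  | _ n ih =>
  subst hn
  set K := surgery G w₀ with hK
  have hKle : K.edgeSet ⊆ G.edgeSet := SimpleGraph.edgeSet_mono (surgery_le G w₀)
  have hKconn : K.Connected := connected_surgery hG hw₀
  have hKm₂ : ∀ e ∈ K.edgeSet, 0 ≤ m₂ e := fun e he => hm₂ e (hKle he)
  obtain ⟨ω₁, hω₁⟩ := exists_isFlow_top hKconn hm₁ hKm₂ fun e he => hw₀ e (hKle he)
  -- The weights of the edges deleted at time zero have to be prescribed as well.
  obtain ⟨ω, hω, h0⟩ : ∃ ω, IsFlow K m₁ m₂ w₀ ⊤ ω ∧ ω 0 = w₀ := by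
    refine ⟨Function.update ω₁ 0 w₀, hω₁.congr fun t e he => ?_, Function.update_self _ _ _⟩
    rcases eq_or_ne t 0 with rfl | ht
    · rw [Function.update_self, hω₁.init e he]
    · rw [Function.update_of_ne ht]
  by_cases hall : ∀ t, 0 ≤ t → NonDegenerate K (ω t)
  · exact ⟨_, _, hω.isSurgeryFlow h0 hall⟩
  push Not at hall
  set S : Set ℝ := {t | 0 ≤ t ∧ ¬NonDegenerate K (ω t)} with hS
  have hSne : S.Nonempty := hall
  have hSbdd : BddBelow S := ⟨0, fun t ht => ht.1⟩
  have hτ0 : 0 ≤ sInf S := le_csInf hSne fun t ht => ht.1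
  have hnd : ∀ t, 0 ≤ t → t < sInf S → NonDegenerate K (ω t) := by
    intro t ht htS
    by_contra hcon
    exact absurd (csInf_le hSbdd ⟨ht, hcon⟩) (not_le.2 htS)
  -- Being non-degenerate is an open condition, so there is a first degenerate time.
  have hd : ¬NonDegenerate K (ω (sInf S)) := by
    intro hcon
    have hev := eventually_nonDegenerate (f := ω) (l := 𝓝[≥] (sInf S)) hKconn
      (hω.pos _ hτ0 (EReal.coe_lt_top _))
      (fun e he => hω.continuousWithinAt_Ici hτ0 (EReal.coe_lt_top _) he) hcon
    obtain ⟨u, hu, hsub⟩ := mem_nhdsGE_iff_exists_Ico_subset.1 hev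
    obtain ⟨s, hs, hsu⟩ := exists_lt_of_csInf_lt hSne (mem_Ioi.1 hu)
    exact hs.2 (hsub ⟨csInf_le hSbdd hs, hsu⟩)
  have hτ : 0 < sInf S := hτ0.lt_of_ne fun h => hd (by
    rw [← h, h0]
    exact nonDegenerate_surgery G w₀)
  obtain ⟨H', ω', h'⟩ := ih _
    (Set.ncard_lt_ncard (SimpleGraph.edgeSet_strict_mono (surgery_lt hd)) (Set.toFinite _))
    hKconn hKm₂ (hω.pos _ hτ0 (EReal.coe_lt_top _)) rfl
  exact ⟨_, _, hω.isSurgeryFlow_glue hτ h0 hnd hd h'⟩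

end SurgeryFlow

end WeightedLLY

theorem theorem3p1 {V : Type*} [Fintype V] (G : SimpleGraph V) (hG : G.Connected)
    (m₁ : V → ℝ) (hm₁ : ∀ x, 0 < m₁ x)
    (m₂ : Sym2 V → ℝ) (hm₂ : ∀ e ∈ G.edgeSet, 0 ≤ m₂ e) :
    -- the curvature is well defined: the defining limit exists
    (∀ w : Sym2 V → ℝ, (∀ e ∈ G.edgeSet, 0 < w e) → ∀ x y : V, x ≠ y →
      Tendsto (WeightedLLY.llyQuotient G m₁ m₂ w x y) (𝓝[>] 0)
        (𝓝 (WeightedLLY.llyCurvature G m₁ m₂ w x y))) ∧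
    ∀ w₀ : Sym2 V → ℝ, (∀ e ∈ G.edgeSet, 0 < w₀ e) →
      -- the flow on the fixed graph
      (∃ ω : ℝ → Sym2 V → ℝ, WeightedLLY.IsFlow G m₁ m₂ w₀ ⊤ ω ∧
        ∀ (T : EReal) (ω' : ℝ → Sym2 V → ℝ), WeightedLLY.IsFlow G m₁ m₂ w₀ T ω' →
          ∀ t : ℝ, 0 ≤ t → (t : EReal) < T → ∀ e ∈ G.edgeSet, ω' t e = ω t e) ∧
      -- the flow with edge surgery
      (∃ (H : ℝ → SimpleGraph V) (ω : ℝ → Sym2 V → ℝ),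
        WeightedLLY.IsSurgeryFlow G m₁ m₂ w₀ ⊤ H ω ∧
        ∀ (T : EReal) (H' : ℝ → SimpleGraph V) (ω' : ℝ → Sym2 V → ℝ),
          WeightedLLY.IsSurgeryFlow G m₁ m₂ w₀ T H' ω' →
          ∀ t : ℝ, 0 ≤ t → (t : EReal) < T →
            H' t = H t ∧ ∀ e ∈ (H t).edgeSet, ω' t e = ω t e) := by
  refine ⟨fun w hw x y hxy => ?_, fun w₀ hw₀ => ⟨?_, ?_⟩⟩
  · rw [WeightedLLY.llyCurvature_eq hG hm₁ hm₂ hw hxy]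
    exact WeightedLLY.tendsto_llyQuotient_of_pos hG hm₁ hm₂ hw hxy
  · obtain ⟨ω, hω⟩ := WeightedLLY.exists_isFlow_top hG hm₁ hm₂ hw₀
    exact ⟨ω, hω, fun T ω' hω' t ht hT =>
      hω'.eq_of_lt hG hm₁ hm₂ hω ht hT (EReal.coe_lt_top t)⟩
  · obtain ⟨H, ω, hω⟩ := WeightedLLY.exists_isSurgeryFlow hG hm₁ hm₂ hw₀
    exact ⟨H, ω, hω, fun T H' ω' hω' t ht hT =>
      hω.eq_of_lt hG hm₁ hm₂ hw₀ hω' ht (EReal.coe_lt_top t) hT⟩
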